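/- Let $X$ be a compact metric space and $T\colon X\to X$ a continuous map such that there is exactly one $T$-invariant Borel probability measure $\mu$ on $X$. For $n\in\mathbb{N}=\{1,2,3,\dots\}$ let $\Omega(n)$ be the number of prime factors of $n$ counted with multiplicity, and write $e(t)=e^{2\pi i t}$. A bounded function $a\colon\mathbb{N}\to\mathbb{C}$ is called Besicovitch almost periodic if for every $\epsilon>0$ there is a trigonometric polynomial $P(n)=c_1e(n\alpha_1)+\dots+c_Le(n\alpha_L)$, with $c_1,\dots,c_L\in\mathbb{C}$ and $\alpha_1,\dots,\alpha_L\in\mathbb{R}$, such that $\limsup_{N\to\infty}\frac1N\sum_{n=1}^N|a(n)-P(n)|\le\epsilon$. (1) Let $a\colon\mathbb{N}\to\mathbb{C}$ be Besicovitch almost periodic. Then the mean value $M(a)=\lim_{N\to\infty}\frac1N\sum_{n=1}^N a(n)$ exists, and for every continuous $f\colon X\to\mathbb{C}$ and every $x\in X$, $$\lim_{N\to\infty}\frac1N\sum_{n=1}^N a(n)\,f\big(T^{\Omega(n)}x\big)=M(a)\int_X f\,d\mu .$$ (2) Let $k\ge 2$ be an integer, and call $n\in\mathbb{N}$ $k$-free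 if it is not divisible by $d^k$ for any integer $d>1$. Then the indicator function of the set of $k$-free numbers is Besicovitch almost periodic with mean value $1/\zeta(k)$, where $\zeta$ is the Riemann zeta function, and for every continuous $f\colon X\to\mathbb{C}$ and every $x\in X$, $$\lim_{N\to\infty}\frac1N\sum_{\substack{1\le n\le N\\ n\ k\text{-free}}} f\big(T^{\Omega(n)}x\big)=\frac1{\zeta(k)}\int_X f\,d\mu .$$ -/

import Mathlib

open Filter Topology MeasureTheory

/-- `μ` is the unique `T`-invariant Borel probability measure on `X`. -/
structure IsUniquelyErgodic {X : Type*} [MeasurableSpace X] (T : X → X) (μ : Measure X) :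
    Prop where
  isProbabilityMeasure : IsProbabilityMeasure μ
  measurePreserving : MeasurePreserving T μ μ
  eq_of_invariant : ∀ ν : Measure X, IsProbabilityMeasure ν → MeasurePreserving T ν ν → ν = μ

/-- The average `(1/N) ∑_{n=1}^N u(n)`. -/
noncomputable def cesaroAvg (u : ℕ → ℂ) (N : ℕ) : ℂ :=
  (1 / (N : ℂ)) * ∑ n ∈ Finset.Icc 1 N, u n

/-- The trigonometric polynomial `P(n) = c_1 e(n α_1) + ⋯ + c_L e(n α_L)`,
where `e(t) = exp(2 π i t)`. -/
noncomputable def trigPoly {L : ℕ} (c : Fin L → ℂ) (α : Fin L → ℝ) (n : ℕ) : ℂ :=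
  ∑ j, c j * Complex.exp (2 * Real.pi * Complex.I * ((n : ℂ) * (α j : ℂ)))

/-- Besicovitch almost periodic arithmetic functions. Only the values at `n ≥ 1` matter.
The averages under the `limsup` form a bounded sequence because `a` is bounded. -/
structure IsBesicovitchAlmostPeriodic (a : ℕ → ℂ) : Prop where
  bounded : ∃ C : ℝ, ∀ n, 1 ≤ n → ‖a n‖ ≤ C
  approx : ∀ ε : ℝ, 0 < ε → ∃ (L : ℕ) (c : Fin L → ℂ) (α : Fin L → ℝ),
    limsup (fun N : ℕ => (1 / (N : ℝ)) * ∑ n ∈ Finset.Icc 1 N, ‖a n - trigPoly c α n‖) atTop ≤ ε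

/-- `n` is `k`-free: no `k`-th power of an integer greater than one divides `n`. -/
def IsKFree (k n : ℕ) : Prop := ∀ d : ℕ, 1 < d → ¬ d ^ k ∣ n

noncomputable instance (k : ℕ) : DecidablePred (IsKFree k) := fun _ => Classical.propDecidable _

/-! Multiplying `n` by a prime raises `Ω(n)` by exactly one, so it acts on `f(T^{Ω(n)}x)` as one
application of `T`. The aim is to show that averages of `u_j(n) = a(n) f(T^{Ω(n)+j}x)` do not feel
`j`. Averaging over `j` then brings in unique ergodicity, through the uniform convergence of ergodic
averages.

The link between `u_j` and `u_{j+1}` is the dual Turán–Kubilius inequality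
(`eventually_turan_kubilius`). For weights `w` on primes with total mass `W`, the average of `u` up
to `t`, times `W`, is close to the sum over `p` of `w_p` times the average of `u(p·)` up to `t/p`.
The squared error is of order `∑ p w_p²`, negligible against `W²` when `p w_p` is bounded and `W` is
large. Density arguments reduce Besicovitch almost periodic `a` to a single exponential `e(nα)`.

Rational `α`, with `qα` an integer: only primes `p ≡ 1 mod q` are used, so that `a(pm) = a(m)`. What
remains is to replace the scale `t/p` by `t`. Limits along an ultrafilter turn averages up to `N
e^{-v}` into a bounded Lipschitz function of `v`. The weights `σ log p · p^{-1-2σ}`, placed at `log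
p`, are asymptotically translation invariant on such functions as `σ → 0`. This is a Wiener–Ikehara
theorem (`tendsto_abel_mean_sub`), fed by the behaviour of Dirichlet `L`-functions on the line `Re s
= 1`. Superposing dyadic values of `σ` makes the mass large while `p w_p` stays at most 2
(`exists_invariant_weights`). Hence the limit averages are constant in `v`, and those of `u_j` and
`u_{j+1}` coincide (`tendsto_cesaroAvg_sub_shift`).

Irrational `α`: with weights `1/p`, the averages of `e(pmα) f(T^{Ω(m)+1}x)` combine into a
correlation with `∑_p e(pmα)`. By Cauchy–Schwarz and bounded geometric sums it is `O(√W)`, so the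
average of `u` is `O(1/√W)`; and `∑ 1/p` diverges (`tendsto_cesaroAvg_addExp_mul_zero`).

For `k`-free numbers, sieving only by `d^k` with `d ≤ D` gives a periodic function, and the tail of
`∑ d^{-k}` bounds the error. The density follows from the unique factorisation `n = d^k m` with `m`
`k`-free. -/

/-! ### Averages along a real parameter and the Turán–Kubilius inequality -/

/-- The average `(1/t) ∑_{1 ≤ n ≤ t} u(n)` for a real parameter `t`. -/
noncomputable def realAvg (u : ℕ → ℂ) (t : ℝ) : ℂ :=
  (t : ℂ)⁻¹ * ∑ n ∈ Finset.Icc 1 ⌊t⌋₊, u n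

lemma cesaroAvg_eq_realAvg (u : ℕ → ℂ) (N : ℕ) : cesaroAvg u N = realAvg u N := by
  simp [cesaroAvg, realAvg]

lemma sum_Icc_norm_le {u : ℕ → ℂ} {C : ℝ} (hu : ∀ n, 1 ≤ n → ‖u n‖ ≤ C) (N : ℕ) :
    ‖∑ n ∈ Finset.Icc 1 N, u n‖ ≤ N * C := by
  refine (norm_sum_le_of_le _ fun n hn => hu n (Finset.mem_Icc.1 hn).1).trans ?_
  simp

lemma realAvg_norm_le {u : ℕ → ℂ} {C : ℝ} (hu : ∀ n, 1 ≤ n → ‖u n‖ ≤ C) {t : ℝ} (ht : 0 < t) :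
    ‖realAvg u t‖ ≤ C := by
  have hC : 0 ≤ C := (norm_nonneg _).trans (hu 1 le_rfl)
  rw [realAvg, norm_mul, norm_inv, Complex.norm_real, Real.norm_of_nonneg ht.le,
    inv_mul_le_iff₀ ht]
  exact (sum_Icc_norm_le hu _).trans (by gcongr; exact Nat.floor_le ht.le)

lemma realAvg_add (u v : ℕ → ℂ) (t : ℝ) :
    realAvg (fun n => u n + v n) t = realAvg u t + realAvg v t := by
  simp [realAvg, Finset.sum_add_distrib, mul_add]

lemma realAvg_sub (u v : ℕ → ℂ) (t : ℝ) :
    realAvg (fun n => u n - v n) t = realAvg u t - realAvg v t := by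
  simp [realAvg, Finset.sum_sub_distrib, mul_sub]

lemma realAvg_const_mul (c : ℂ) (u : ℕ → ℂ) (t : ℝ) :
    realAvg (fun n => c * u n) t = c * realAvg u t := by
  simp only [realAvg, ← Finset.mul_sum]; ring

lemma realAvg_sum {ι : Type*} (s : Finset ι) (u : ι → ℕ → ℂ) (t : ℝ) :
    realAvg (fun n => ∑ i ∈ s, u i n) t = ∑ i ∈ s, realAvg (u i) t := by
  simp only [realAvg, ← Finset.mul_sum]
  rw [Finset.sum_comm]

lemma sum_Icc_dvd (u : ℕ → ℂ) {d : ℕ} (hd : 0 < d) (N : ℕ) :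
    ∑ n ∈ Finset.Icc 1 N, (if d ∣ n then u n else 0) =
      ∑ m ∈ Finset.Icc 1 (N / d), u (d * m) := by
  rw [← Finset.sum_filter]
  symm
  refine Finset.sum_bij (fun m _ => d * m) ?_ ?_ ?_ ?_
  · intro m hm
    rw [Finset.mem_Icc] at hm
    simp only [Finset.mem_filter, Finset.mem_Icc, dvd_mul_right, and_true]
    refine ⟨Nat.mul_pos hd hm.1, ?_⟩
    rw [mul_comm]
    exact (Nat.le_div_iff_mul_le hd).1 hm.2
  · intro a _ b _ h
    exact Nat.eq_of_mul_eq_mul_left hd h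
  · intro n hn
    simp only [Finset.mem_filter, Finset.mem_Icc] at hn
    obtain ⟨⟨h1, h2⟩, m, rfl⟩ := hn
    refine ⟨m, Finset.mem_Icc.2 ⟨Nat.pos_of_mul_pos_left h1, ?_⟩, rfl⟩
    rw [Nat.le_div_iff_mul_le hd, mul_comm]
    exact h2
  · intros; rfl

/-- The substitution `n = dm` changes the scale to `t/d`, which is why averages carry a real
parameter. -/
lemma realAvg_dvd (u : ℕ → ℂ) {d : ℕ} (hd : 0 < d) (t : ℝ) :
    realAvg (fun n => if d ∣ n then u n else 0) t =
      (d : ℂ)⁻¹ * realAvg (fun m => u (d * m)) (t / d) := by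
  have hd' : (d : ℂ) ≠ 0 := by exact_mod_cast hd.ne'
  simp only [realAvg]
  rw [sum_Icc_dvd u hd, Nat.floor_div_natCast]
  push_cast
  rw [inv_div, ← mul_assoc, ← mul_div_assoc, inv_mul_cancel₀ hd', one_div]

lemma tendsto_realAvg_one : Tendsto (realAvg fun _ => 1) atTop (𝓝 1) := by
  have h := (tendsto_nat_floor_div_atTop (R := ℝ))
  have h2 := (Complex.continuous_ofReal.tendsto 1).comp h
  refine Tendsto.congr (fun t => ?_) (by simpa using h2)
  simp [realAvg, div_eq_inv_mul]

lemma tendsto_realAvg_dvd {d : ℕ} (hd : 0 < d) :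
    Tendsto (realAvg fun n => if d ∣ n then 1 else 0) atTop (𝓝 (d : ℂ)⁻¹) := by
  have h1 : Tendsto (fun t : ℝ => t / d) atTop atTop :=
    tendsto_id.atTop_div_const (by exact_mod_cast hd)
  have h2 := (tendsto_realAvg_one.comp h1).const_mul (d : ℂ)⁻¹
  rw [mul_one] at h2
  exact h2.congr fun t => (realAvg_dvd (fun _ => 1) hd t).symm

/-- Cauchy–Schwarz. It serves both the Turán–Kubilius inequality and the irrational frequencies. -/
lemma norm_sq_realAvg_mul_le {u g : ℕ → ℂ} {C : ℝ} (hu : ∀ n, 1 ≤ n → ‖u n‖ ≤ C) {t : ℝ}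
    (ht : 0 < t) :
    ‖realAvg (fun n => u n * g n) t‖ ^ 2 ≤
      C ^ 2 * ‖realAvg (fun n => ((‖g n‖ ^ 2 : ℝ) : ℂ)) t‖ := by
  have hC : 0 ≤ C := (norm_nonneg _).trans (hu 1 le_rfl)
  have h1 : ‖∑ n ∈ Finset.Icc 1 ⌊t⌋₊, u n * g n‖ ≤ C * ∑ n ∈ Finset.Icc 1 ⌊t⌋₊, ‖g n‖ := by
    rw [Finset.mul_sum]
    refine norm_sum_le_of_le _ fun n hn => ?_
    rw [norm_mul]
    gcongr
    exact hu n (Finset.mem_Icc.1 hn).1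
  have h2 : (∑ n ∈ Finset.Icc 1 ⌊t⌋₊, ‖g n‖) ^ 2 ≤ t * ∑ n ∈ Finset.Icc 1 ⌊t⌋₊, ‖g n‖ ^ 2 := by
    refine sq_sum_le_card_mul_sum_sq.trans ?_
    gcongr
    simpa using Nat.floor_le ht.le
  have h3 : ‖realAvg (fun n => ((‖g n‖ ^ 2 : ℝ) : ℂ)) t‖ =
      t⁻¹ * ∑ n ∈ Finset.Icc 1 ⌊t⌋₊, ‖g n‖ ^ 2 := by
    rw [realAvg, ← Complex.ofReal_sum, ← Complex.ofReal_inv, ← Complex.ofReal_mul,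
      Complex.norm_real, Real.norm_of_nonneg]
    positivity
  rw [h3, realAvg, norm_mul, norm_inv, Complex.norm_real, Real.norm_of_nonneg ht.le, mul_pow]
  calc t⁻¹ ^ 2 * ‖∑ n ∈ Finset.Icc 1 ⌊t⌋₊, u n * g n‖ ^ 2
      ≤ t⁻¹ ^ 2 * (C * ∑ n ∈ Finset.Icc 1 ⌊t⌋₊, ‖g n‖) ^ 2 := by gcongr
    _ = t⁻¹ ^ 2 * C ^ 2 * (∑ n ∈ Finset.Icc 1 ⌊t⌋₊, ‖g n‖) ^ 2 := by ring
    _ ≤ t⁻¹ ^ 2 * C ^ 2 * (t * ∑ n ∈ Finset.Icc 1 ⌊t⌋₊, ‖g n‖ ^ 2) := by gcongr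
    _ = C ^ 2 * (t⁻¹ * ∑ n ∈ Finset.Icc 1 ⌊t⌋₊, ‖g n‖ ^ 2) := by
      field_simp

/-- The weighted, centred count of the prime divisors of `n` in `P`. -/
noncomputable def primeDeviation (P : Finset ℕ) (w : ℕ → ℝ) (n : ℕ) : ℂ :=
  ∑ p ∈ P, (p * w p : ℂ) * ((if p ∣ n then 1 else 0) - (p : ℂ)⁻¹)

lemma primeDeviation_norm_sq (P : Finset ℕ) (w : ℕ → ℝ) (n : ℕ) :
    ((‖primeDeviation P w n‖ ^ 2 : ℝ) : ℂ) = ∑ p ∈ P, ∑ q ∈ P, (p * w p * (q * w q) : ℂ) *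
      (((if p ∣ n then 1 else 0) - (p : ℂ)⁻¹) * ((if q ∣ n then 1 else 0) - (q : ℂ)⁻¹)) := by
  have h : (starRingEnd ℂ) (primeDeviation P w n) = primeDeviation P w n := by
    simp [primeDeviation, map_sum, apply_ite]
  rw [Complex.ofReal_pow, ← Complex.mul_conj', h, primeDeviation, Finset.sum_mul_sum]
  refine Finset.sum_congr rfl fun p _ => Finset.sum_congr rfl fun q _ => by ring

/-- Divisibility by distinct primes is asymptotically independent, and on the diagonal the variance
of a Bernoulli variable of parameter `1/p` appears. -/
lemma tendsto_realAvg_covariance {p q : ℕ} (hp : p.Prime) (hq : q.Prime) :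
    Tendsto (realAvg fun n => ((if p ∣ n then 1 else 0) - (p : ℂ)⁻¹) *
      ((if q ∣ n then 1 else 0) - (q : ℂ)⁻¹)) atTop
      (𝓝 (if p = q then (p : ℂ)⁻¹ - (p : ℂ)⁻¹ ^ 2 else 0)) := by
  -- `d` is the least common multiple of `p` and `q`.
  set d := if p = q then p else p * q with hd
  have hd0 : 0 < d := by
    rw [hd]; split_ifs
    exacts [hp.pos, Nat.mul_pos hp.pos hq.pos]
  have hdvd : ∀ n, (d ∣ n ↔ p ∣ n ∧ q ∣ n) := by
    intro n
    rw [hd]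
    split_ifs with h
    · subst h; simp
    · constructor
      · intro h'
        exact ⟨(dvd_mul_right p q).trans h', (dvd_mul_left q p).trans h'⟩
      · rintro ⟨h1, h2⟩
        exact ((Nat.coprime_primes hp hq).2 h).mul_dvd_of_dvd_of_dvd h1 h2
  have key := (((tendsto_realAvg_dvd hd0).sub
    ((tendsto_realAvg_dvd hp.pos).const_mul (q : ℂ)⁻¹)).sub
    ((tendsto_realAvg_dvd hq.pos).const_mul (p : ℂ)⁻¹)).add
    (tendsto_realAvg_one.const_mul ((p : ℂ)⁻¹ * (q : ℂ)⁻¹))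
  have hlim : (d : ℂ)⁻¹ - (q : ℂ)⁻¹ * (p : ℂ)⁻¹ - (p : ℂ)⁻¹ * (q : ℂ)⁻¹ +
      (p : ℂ)⁻¹ * (q : ℂ)⁻¹ * 1 = if p = q then (p : ℂ)⁻¹ - (p : ℂ)⁻¹ ^ 2 else 0 := by
    rw [hd]
    split_ifs with h
    · subst h; ring
    · push_cast; rw [mul_inv]; ring
  rw [hlim] at key
  refine key.congr fun t => ?_
  rw [← realAvg_const_mul, ← realAvg_const_mul, ← realAvg_const_mul, ← realAvg_sub, ← realAvg_sub,
    ← realAvg_add]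
  congr 1
  funext n
  by_cases h1 : p ∣ n <;> by_cases h2 : q ∣ n <;> simp [hdvd, h1, h2] <;> ring

/-- Only the diagonal survives: `p² w_p² (1/p - 1/p²) = (p-1) w_p²`. As `P` is fixed while `t → ∞`,
no uniformity in `P` is needed. -/
lemma tendsto_realAvg_primeDeviation {P : Finset ℕ} (hP : ∀ p ∈ P, p.Prime) (w : ℕ → ℝ) :
    Tendsto (realAvg fun n => ((‖primeDeviation P w n‖ ^ 2 : ℝ) : ℂ)) atTop
      (𝓝 ((∑ p ∈ P, (p - 1) * w p ^ 2 : ℝ) : ℂ)) := by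
  have key : Tendsto (fun t => ∑ p ∈ P, ∑ q ∈ P, (p * w p * (q * w q) : ℂ) *
      realAvg (fun n => ((if p ∣ n then 1 else 0) - (p : ℂ)⁻¹) *
      ((if q ∣ n then 1 else 0) - (q : ℂ)⁻¹)) t) atTop
      (𝓝 (∑ p ∈ P, ∑ q ∈ P, (p * w p * (q * w q) : ℂ) *
        (if p = q then (p : ℂ)⁻¹ - (p : ℂ)⁻¹ ^ 2 else 0))) :=
    tendsto_finsetSum _ fun p hp => tendsto_finsetSum _ fun q hq =>
      (tendsto_realAvg_covariance (hP p hp) (hP q hq)).const_mul _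
  have hlim : ∑ p ∈ P, ∑ q ∈ P, (p * w p * (q * w q) : ℂ) *
        (if p = q then (p : ℂ)⁻¹ - (p : ℂ)⁻¹ ^ 2 else 0) =
        ((∑ p ∈ P, (p - 1) * w p ^ 2 : ℝ) : ℂ) := by
    push_cast
    refine Finset.sum_congr rfl fun p hp => ?_
    have : (p : ℂ) ≠ 0 := by exact_mod_cast (hP p hp).ne_zero
    simp only [mul_ite, mul_zero, Finset.sum_ite_eq, hp, if_true]
    field_simp
  rw [hlim] at key
  refine key.congr fun t => ?_
  simp_rw [primeDeviation_norm_sq, realAvg_sum, realAvg_const_mul]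

/-- The factor `p` in `primeDeviation` cancels the `1/p` coming from `realAvg_dvd`. -/
lemma realAvg_mul_primeDeviation (u : ℕ → ℂ) {P : Finset ℕ} (hP : ∀ p ∈ P, p.Prime) (w : ℕ → ℝ)
    (t : ℝ) : realAvg (fun n => u n * primeDeviation P w n) t =
      ∑ p ∈ P, (w p : ℂ) * realAvg (fun m => u (p * m)) (t / p) -
        (∑ p ∈ P, (w p : ℂ)) * realAvg u t := by
  rw [Finset.sum_mul, ← Finset.sum_sub_distrib]
  simp_rw [primeDeviation, Finset.mul_sum]
  rw [realAvg_sum]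
  refine Finset.sum_congr rfl fun p hp => ?_
  have hp0 : (p : ℂ) ≠ 0 := by exact_mod_cast (hP p hp).ne_zero
  have h1 := realAvg_dvd u (hP p hp).pos t
  have h2 : (fun n => u n * ((p * w p : ℂ) * ((if p ∣ n then 1 else 0) - (p : ℂ)⁻¹))) =
      fun n => (p * w p : ℂ) * (if p ∣ n then u n else 0) - (w p : ℂ) * u n := by
    funext n
    split_ifs <;> field_simp
    ring
  rw [h2, realAvg_sub, realAvg_const_mul, realAvg_const_mul, h1]
  field_simp

/-- The (dual) Turán–Kubilius inequality, in asymptotic form. -/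
theorem eventually_turan_kubilius {u : ℕ → ℂ} {C : ℝ} (hu : ∀ n, 1 ≤ n → ‖u n‖ ≤ C)
    {P : Finset ℕ} (hP : ∀ p ∈ P, p.Prime) (w : ℕ → ℝ) {δ : ℝ}
    (hδ : C ^ 2 * ∑ p ∈ P, p * w p ^ 2 < δ) :
    ∀ᶠ t in atTop, ‖(∑ p ∈ P, (w p : ℂ)) * realAvg u t -
      ∑ p ∈ P, (w p : ℂ) * realAvg (fun m => u (p * m)) (t / p)‖ ^ 2 < δ := by
  have h1 := ((tendsto_realAvg_primeDeviation hP w).norm).const_mul (C ^ 2)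
  have hle : C ^ 2 * ‖((∑ p ∈ P, (p - 1) * w p ^ 2 : ℝ) : ℂ)‖ < δ := by
    refine lt_of_le_of_lt ?_ hδ
    rw [Complex.norm_real, Real.norm_of_nonneg]
    · gcongr with p hp
      linarith
    · refine Finset.sum_nonneg fun p hp => mul_nonneg ?_ (sq_nonneg _)
      have : (1 : ℝ) ≤ p := by exact_mod_cast (hP p hp).one_le
      linarith
  filter_upwards [h1.eventually_lt_const hle, eventually_gt_atTop 0] with t ht ht0
  rw [norm_sub_rev, ← realAvg_mul_primeDeviation u hP w t]
  exact (norm_sq_realAvg_mul_le hu ht0).trans_lt ht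

/-! ### A Tauberian theorem of Wiener–Ikehara type -/

/-- The additive character `e(x) = exp(2πix)`. -/
noncomputable def addExp (x : ℝ) : ℂ := Complex.exp (2 * Real.pi * Complex.I * x)

@[simp] lemma norm_addExp (x : ℝ) : ‖addExp x‖ = 1 := by
  rw [addExp, show (2 * Real.pi * Complex.I * x : ℂ) = (2 * Real.pi * x : ℝ) * Complex.I by
    push_cast; ring, Complex.norm_exp_ofReal_mul_I]

@[simp] lemma addExp_zero : addExp 0 = 1 := by simp [addExp]

lemma addExp_add (x y : ℝ) : addExp (x + y) = addExp x * addExp y := by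
  rw [addExp, addExp, addExp, ← Complex.exp_add]; push_cast; ring_nf

@[fun_prop] lemma continuous_addExp : Continuous addExp := by unfold addExp; fun_prop

lemma fourierChar_smul (x : ℝ) (z : ℂ) : Real.fourierChar x • z = addExp x * z := by
  rw [Circle.smul_def, smul_eq_mul, Real.fourierChar_apply, addExp]
  congr 2
  push_cast; ring

open FourierTransform in
/-- Band-limited approximate identities. -/
lemma exists_bandlimited_kernel {η : ℝ} (hη : 0 < η) : ∃ χ φ : ℝ → ℂ, Continuous χ ∧
    HasCompactSupport χ ∧ Continuous φ ∧ Integrable φ ∧ Integrable (fun u => |u| * ‖φ u‖) ∧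
    ∫ u, φ u = 1 ∧ ∫ u, |u| * ‖φ u‖ ≤ η ∧
    ∀ v, φ v = ∫ t, χ t * addExp (t * v) := by
  let b : ContDiffBump (0 : ℝ) := ⟨1, 2, one_pos, one_lt_two⟩
  have hbc : HasCompactSupport (fun x => (b x : ℂ)) := b.hasCompactSupport.comp_left (g := Complex.ofReal) Complex.ofReal_zero
  have hb : ContDiff ℝ ((⊤ : ℕ∞) : WithTop ℕ∞) (fun x => b x) := b.contDiff
  have hbs : ContDiff ℝ ((⊤ : ℕ∞) : WithTop ℕ∞) (fun x => (b x : ℂ)) :=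
    Complex.ofRealCLM.contDiff.comp hb
  let f : SchwartzMap ℝ ℂ := hbc.toSchwartzMap hbs
  have hf : ∀ x, f x = b x := fun x => rfl
  let g : SchwartzMap ℝ ℂ := 𝓕⁻ f
  have hg : ∀ v, g v = ∫ t, f t * addExp (t * v) := by
    intro v
    change (𝓕⁻ f) v = _
    rw [SchwartzMap.fourierInv_coe, Real.fourierInv_eq]
    refine integral_congr_ae (ae_of_all _ fun t => ?_)
    simp [fourierChar_smul, mul_comm]
  -- The total integral is the Fourier transform at 0, where the bump function equals 1.
  have hg1 : ∫ u, g u = 1 := by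
    have h1 : 𝓕 g = f := by simp [g]
    have h2 : (𝓕 g) 0 = 1 := by
      rw [h1, hf, b.one_of_mem_closedBall]
      · simp
      · simp [b]
    rw [SchwartzMap.fourier_coe, Real.fourier_eq] at h2
    simpa [fourierChar_smul] using h2
  set M := ∫ u, |u| * ‖g u‖ with hM
  have hM0 : 0 ≤ M := integral_nonneg fun u => by positivity
  have hgi : Integrable (fun u => |u| * ‖g u‖) := by
    simpa using g.integrable_pow_mul volume 1
  -- Dilation by `R` keeps the integral and divides the first moment `M` by `R`; `M + 1` avoids a
  -- vanishing `R`.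
  set R := (M + 1) / η with hR
  have hR0 : 0 < R := by positivity
  have hRa : |R⁻¹| = R⁻¹ := abs_of_pos (inv_pos.2 hR0)
  have hnorm : ∀ u, |u| * ‖(R : ℂ) * g (R * u)‖ = |R * u| * ‖g (R * u)‖ := by
    intro u
    rw [norm_mul, Complex.norm_real, Real.norm_of_nonneg hR0.le, abs_mul, abs_of_pos hR0]
    ring
  refine ⟨fun t => f (R⁻¹ * t), fun u => R * g (R * u), by fun_prop, ?_, by fun_prop, ?_, ?_, ?_,
    ?_, ?_⟩
  · exact hbc.comp_homeomorph (Homeomorph.mulLeft₀ R⁻¹ (inv_ne_zero hR0.ne'))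
  · exact (g.integrable.comp_mul_left' hR0.ne').const_mul _
  · simp_rw [hnorm]
    exact hgi.comp_mul_left' hR0.ne'
  · rw [integral_const_mul, Measure.integral_comp_mul_left (fun x => g x), hg1, hRa]
    simp [hR0.ne']
  · simp_rw [hnorm]
    rw [Measure.integral_comp_mul_left (fun u => |u| * ‖g u‖), ← hM, hRa, smul_eq_mul, hR, inv_div,
      div_mul_eq_mul_div, div_le_iff₀ (by positivity)]
    nlinarith
  · intro v
    have h := Measure.integral_comp_mul_left
      (fun t => f t * addExp (t * (R * v))) R⁻¹
    rw [inv_inv, abs_of_pos hR0] at h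
    simp only [hg]
    rw [← Complex.real_smul, ← h]
    refine integral_congr_ae (ae_of_all _ fun t => ?_)
    simp only
    rw [show R⁻¹ * t * (R * v) = t * v by field_simp]

/-- Since `φ` has integral 1, the error is `∫ (k(u+v) - k(v)) φ(u) du`, controlled by the Lipschitz
constant times the first moment. -/
lemma norm_smoothing_sub_le {φ k : ℝ → ℂ} {η L : ℝ} (hφ : Integrable φ)
    (hφ1 : Integrable (fun u => |u| * ‖φ u‖)) (hφ2 : ∫ u, φ u = 1) (hφ3 : ∫ u, |u| * ‖φ u‖ ≤ η)
    (hk : Continuous k) (hL : ∀ x y, ‖k x - k y‖ ≤ L * |x - y|) (v : ℝ) :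
    ‖(∫ u, k u * φ (u - v)) - k v‖ ≤ L * η := by
  have hL0 : 0 ≤ L := by simpa using (norm_nonneg _).trans (hL 0 1)
  have hb : ∀ u, ‖(k (u + v) - k v) * φ u‖ ≤ L * (|u| * ‖φ u‖) := fun u => by
    rw [norm_mul, ← mul_assoc]
    gcongr
    simpa using hL (u + v) v
  have hi : Integrable fun u => (k (u + v) - k v) * φ u :=
    (hφ1.const_mul L).mono' (by fun_prop) (ae_of_all _ hb)
  have h1 : ∫ u, k u * φ (u - v) = ∫ u, k (u + v) * φ u := by
    rw [← integral_add_right_eq_self (fun u => k u * φ (u - v)) v]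
    simp
  have h2 : ∫ u, k (u + v) * φ u = (∫ u, (k (u + v) - k v) * φ u) + k v := by
    have : ∀ u, k (u + v) * φ u = (k (u + v) - k v) * φ u + k v * φ u := fun u => by ring
    simp_rw [this]
    rw [integral_add hi (hφ.const_mul _), integral_const_mul, hφ2, mul_one]
  rw [h1, h2, add_sub_cancel_right]
  refine (norm_integral_le_of_norm_le (hφ1.const_mul L) (ae_of_all _ hb)).trans ?_
  rw [integral_const_mul]
  gcongr

/-- The Fourier transform of a measure. -/
noncomputable def measFourier (ν : Measure ℝ) (t : ℝ) : ℂ :=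
  ∫ v, addExp (-(t * v)) ∂ν

/-- Fubini twice. Only the Fourier transform of `ν` on the support of `χ` enters, so continuity of
the boundary function on compact sets is enough. -/
lemma integral_smoothing_eq (ν : Measure ℝ) [IsFiniteMeasure ν] {χ φ k : ℝ → ℂ}
    (hχ : Integrable χ) (hφc : Continuous φ)
    (hφ : ∀ v, φ v = ∫ t, χ t * addExp (t * v))
    (hk : Continuous k) (hki : Integrable k) :
    ∫ v, (∫ u, k u * φ (u - v)) ∂ν =
      ∫ u, k u * ∫ t, χ t * addExp (t * u) * measFourier ν t := by
  have hφb : ∀ v, ‖φ v‖ ≤ ∫ t, ‖χ t‖ := fun v => by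
    rw [hφ]
    refine (norm_integral_le_integral_norm _).trans_eq ?_
    simp
  rw [integral_integral_swap]
  · refine integral_congr_ae (ae_of_all _ fun u => ?_)
    simp only
    rw [integral_const_mul]
    congr 1
    simp_rw [hφ]
    rw [integral_integral_swap]
    · refine integral_congr_ae (ae_of_all _ fun t => ?_)
      simp only
      rw [measFourier, ← integral_const_mul]
      refine integral_congr_ae (ae_of_all _ fun v => ?_)
      simp only
      rw [mul_assoc, mul_sub, sub_eq_add_neg, addExp_add]
    · have : Integrable (fun z : ℝ × ℝ => (1 : ℂ) * χ z.2) (ν.prod volume) :=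
        (integrable_const (1 : ℂ)).mul_prod hχ
      refine this.norm.mono' ?_ (ae_of_all _ fun z => ?_)
      · refine AEStronglyMeasurable.mul ?_ (Continuous.aestronglyMeasurable
          (continuous_addExp.comp (by fun_prop)))
        simpa using this.aestronglyMeasurable
      · simp [Function.uncurry]
  · have : Integrable (fun z : ℝ × ℝ => ((∫ t, ‖χ t‖ : ℝ) : ℂ) * k z.2) (ν.prod volume) :=
      (integrable_const _).mul_prod hki
    refine this.norm.mono' (Continuous.aestronglyMeasurable (by fun_prop)) (ae_of_all _ fun z => ?_)
    simp only [Function.uncurry, norm_mul, Complex.norm_real]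
    rw [mul_comm]
    gcongr
    exact (hφb _).trans (le_abs_self _)

lemma integrable_exp_neg_mul_abs {σ : ℝ} (hσ : 0 < σ) :
    Integrable fun u : ℝ => Real.exp (-σ * |u|) := by
  rw [← integrableOn_univ, ← Set.Iic_union_Ioi (a := (0 : ℝ))]
  refine IntegrableOn.union ?_ ?_
  · refine (integrableOn_exp_mul_Iic hσ 0).congr_fun (fun u hu => ?_) measurableSet_Iic
    simp [abs_of_nonpos (Set.mem_Iic.1 hu)]
  · refine (integrableOn_exp_mul_Ioi (neg_lt_zero.2 hσ) 0).congr_fun (fun u hu => ?_)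
      measurableSet_Ioi
    simp [abs_of_pos (Set.mem_Ioi.1 hu)]

lemma integral_exp_neg_mul_abs_comp {σ : ℝ} (hσ : 0 < σ) (f : ℝ → ℝ) :
    σ * ∫ u, Real.exp (-σ * |u|) * f u = ∫ y, Real.exp (-|y|) * f (σ⁻¹ * y) := by
  have h := Measure.integral_comp_mul_left (fun u => Real.exp (-σ * |u|) * f u) σ⁻¹
  rw [inv_inv, abs_of_pos hσ, smul_eq_mul] at h
  rw [← h]
  refine integral_congr_ae (ae_of_all _ fun y => ?_)
  simp only [abs_mul, abs_inv, abs_of_pos hσ]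
  congr 2
  field_simp

/-- Abel means of a bounded function vanishing at infinity tend to zero. -/
lemma tendsto_abel_mean_zero {f : ℝ → ℝ} (hf : Continuous f) {B : ℝ} (hB : ∀ u, |f u| ≤ B)
    (h0 : Tendsto f (cocompact ℝ) (𝓝 0)) :
    Tendsto (fun σ : ℝ => σ * ∫ u, Real.exp (-σ * |u|) * f u) (𝓝[>] 0) (𝓝 0) := by
  have key : Tendsto (fun σ : ℝ => ∫ y, Real.exp (-|y|) * f (σ⁻¹ * y)) (𝓝[>] 0)
      (𝓝 (∫ _ : ℝ, (0 : ℝ))) := by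
    refine tendsto_integral_filter_of_dominated_convergence (fun y => Real.exp (-1 * |y|) * B)
      (Eventually.of_forall fun σ => Continuous.aestronglyMeasurable (by fun_prop))
      (Eventually.of_forall fun σ => ae_of_all _ fun y => ?_)
      ((integrable_exp_neg_mul_abs one_pos).mul_const B) ?_
    · rw [norm_mul, Real.norm_of_nonneg (Real.exp_pos _).le, neg_one_mul]
      gcongr
      exact hB _
    · have hne : ∀ᵐ y : ℝ, y ≠ 0 := by simp [ae_iff]
      filter_upwards [hne] with y hy
      have h1 : Tendsto (fun σ : ℝ => σ⁻¹ * y) (𝓝[>] 0) (cocompact ℝ) := by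
        rw [← Metric.cobounded_eq_cocompact, ← comap_norm_atTop, tendsto_comap_iff]
        have : Tendsto (fun σ : ℝ => σ⁻¹ * |y|) (𝓝[>] 0) atTop :=
          tendsto_inv_nhdsGT_zero.atTop_mul_const (abs_pos.2 hy)
        refine this.congr' ?_
        filter_upwards [self_mem_nhdsWithin] with σ hσ
        rw [Function.comp_apply, norm_mul, Real.norm_eq_abs, Real.norm_eq_abs, abs_inv,
          abs_of_pos (Set.mem_Ioi.1 hσ)]
      simpa using (h0.comp h1).const_mul (Real.exp (-|y|))
  rw [integral_zero] at key
  refine key.congr' ?_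
  filter_upwards [self_mem_nhdsWithin] with σ hσ
  exact (integral_exp_neg_mul_abs_comp hσ f).symm

lemma integral_exp_neg_mul_abs {σ : ℝ} (hσ : 0 < σ) :
    σ * ∫ u : ℝ, Real.exp (-σ * |u|) = ∫ y : ℝ, Real.exp (-|y|) := by
  simpa using integral_exp_neg_mul_abs_comp hσ fun _ => 1

lemma abs_exp_neg_sub_exp_neg_le {a b : ℝ} (ha : 0 ≤ a) (hb : 0 ≤ b) :
    |Real.exp (-a) - Real.exp (-b)| ≤ |a - b| := by
  wlog h : a ≤ b generalizing a b
  · rw [abs_sub_comm, abs_sub_comm a]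
    exact this hb ha (le_of_not_ge h)
  have h1 : Real.exp (-b) ≤ Real.exp (-a) := Real.exp_le_exp.2 (by linarith)
  rw [abs_of_nonneg (by linarith), abs_of_nonpos (by linarith)]
  have h2 := Real.add_one_le_exp (-(b - a))
  have h3 : Real.exp (-b) = Real.exp (-a) * Real.exp (-(b - a)) := by
    rw [← Real.exp_add]; ring_nf
  have h4 : Real.exp (-a) ≤ 1 := Real.exp_le_one_iff.2 (by linarith)
  have h5 := Real.exp_pos (-a)
  rw [h3]
  nlinarith

/-- The constant `L + C` is the same for all `σ` in `(0, 1]`, so one kernel serves all small `σ`. -/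
lemma norm_damped_sub_le {f : ℝ → ℂ} {C L σ : ℝ} (hC : ∀ x, ‖f x‖ ≤ C)
    (hL : ∀ x y, ‖f x - f y‖ ≤ L * |x - y|) (hσ : 0 < σ) (hσ1 : σ ≤ 1) (x y : ℝ) :
    ‖f x * (Real.exp (-σ * |x|) : ℂ) - f y * (Real.exp (-σ * |y|) : ℂ)‖ ≤ (L + C) * |x - y| := by
  have hC0 : 0 ≤ C := (norm_nonneg _).trans (hC 0)
  have e : f x * (Real.exp (-σ * |x|) : ℂ) - f y * (Real.exp (-σ * |y|) : ℂ) =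
      (f x - f y) * (Real.exp (-σ * |x|) : ℂ) +
        f y * ((Real.exp (-(σ * |x|)) - Real.exp (-(σ * |y|)) : ℝ) : ℂ) := by
    push_cast; ring_nf
  rw [e, add_mul]
  refine (norm_add_le _ _).trans (add_le_add ?_ ?_)
  · rw [norm_mul, Complex.norm_real, Real.norm_of_nonneg (Real.exp_pos _).le]
    have h1 : Real.exp (-σ * |x|) ≤ 1 :=
      Real.exp_le_one_iff.2 (by nlinarith [abs_nonneg x])
    calc _ ≤ ‖f x - f y‖ * 1 := by gcongr
      _ ≤ _ := by simpa using hL x y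
  · rw [norm_mul, Complex.norm_real, Real.norm_eq_abs]
    refine mul_le_mul (hC y) ?_ (abs_nonneg _) hC0
    · refine (abs_exp_neg_sub_exp_neg_le (by positivity) (by positivity)).trans ?_
      rw [← mul_sub, abs_mul, abs_of_pos hσ]
      calc σ * |(|x| - |y|)| ≤ 1 * |x - y| :=
            mul_le_mul hσ1 (abs_abs_sub_abs_le x y) (abs_nonneg _) zero_le_one
        _ = _ := one_mul _

lemma norm_integral_smoothing_sub_le {φ k : ℝ → ℂ} {η L D : ℝ} (hφ : Integrable φ)
    (hφc : Continuous φ)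
    (hφ1 : Integrable (fun u => |u| * ‖φ u‖)) (hφ2 : ∫ u, φ u = 1) (hφ3 : ∫ u, |u| * ‖φ u‖ ≤ η)
    (hk : Continuous k) (hkb : ∀ x, ‖k x‖ ≤ D) (hL : ∀ x y, ‖k x - k y‖ ≤ L * |x - y|)
    (ν : Measure ℝ) [IsFiniteMeasure ν] :
    ‖∫ v, (∫ u, k u * φ (u - v)) ∂ν - ∫ v, k v ∂ν‖ ≤ L * η * ν.real Set.univ := by
  have h := norm_smoothing_sub_le hφ hφ1 hφ2 hφ3 hk hL
  have hki : Integrable k ν :=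
    (integrable_const D).mono' hk.aestronglyMeasurable (ae_of_all _ hkb)
  have hsi : Integrable (fun v => ∫ u, k u * φ (u - v)) ν := by
    refine (integrable_const (L * η + D)).mono' ?_ (ae_of_all _ fun v => ?_)
    · have : StronglyMeasurable (fun z : ℝ × ℝ => k z.2 * φ (z.2 - z.1)) :=
        Continuous.stronglyMeasurable (by fun_prop)
      exact this.integral_prod_right'.aestronglyMeasurable
    · calc ‖∫ u, k u * φ (u - v)‖ = ‖((∫ u, k u * φ (u - v)) - k v) + k v‖ := by simp
        _ ≤ _ := (norm_add_le _ _).trans (add_le_add (h v) (hkb v))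
  rw [← integral_sub hsi hki]
  exact norm_integral_le_of_norm_le_const (ae_of_all _ h)

lemma continuous_of_norm_sub_le {f : ℝ → ℂ} {L : ℝ} (hL : ∀ x y, ‖f x - f y‖ ≤ L * |x - y|) : Continuous f := by
  have hL0 : 0 ≤ L := by simpa using (norm_nonneg _).trans (hL 0 1)
  refine (LipschitzWith.of_dist_le_mul (K := ⟨L, hL0⟩) fun x y => ?_).continuous
  rw [dist_eq_norm, Real.dist_eq]
  exact hL x y

lemma tendsto_of_continuousOn_uncurry {G : ℝ → ℝ → ℂ}
    (hG : ContinuousOn (Function.uncurry G) (Set.Ici 0 ×ˢ Set.univ)) (t : ℝ) :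
    Tendsto (fun σ => G σ t) (𝓝[>] 0) (𝓝 (G 0 t)) := by
  have h1 : ContinuousWithinAt (Function.uncurry G) (Set.Ici 0 ×ˢ Set.univ) (0, t) :=
    hG (0, t) (by simp)
  have h2 : Tendsto (fun σ : ℝ => (σ, t)) (𝓝[>] 0) (𝓝[Set.Ici 0 ×ˢ Set.univ] (0, t)) := by
    refine tendsto_nhdsWithin_iff.2 ⟨?_, ?_⟩
    · exact (Continuous.tendsto (by fun_prop) (0 : ℝ)).mono_left nhdsWithin_le_nhds
    · filter_upwards [self_mem_nhdsWithin] with σ hσ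
      exact ⟨(Set.mem_Ioi.1 hσ).le, trivial⟩
  exact h1.tendsto.comp h2

/-- A Tauberian theorem: if the Fourier transforms of two families of measures differ by a
function that stays continuous up to `σ = 0`, then the families have asymptotically the same
Abel means against bounded Lipschitz functions. -/
theorem tendsto_abel_mean_sub {ν₁ ν₂ : ℝ → Measure ℝ} (h₁ : ∀ σ, 0 < σ → IsFiniteMeasure (ν₁ σ))
    (h₂ : ∀ σ, 0 < σ → IsFiniteMeasure (ν₂ σ)) {G : ℝ → ℝ → ℂ}
    (hG : ContinuousOn (Function.uncurry G) (Set.Ici 0 ×ˢ Set.univ))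
    (hFT : ∀ σ, 0 < σ → ∀ t, measFourier (ν₁ σ) t - measFourier (ν₂ σ) t = G σ t) {B : ℝ}
    (hB : ∀ᶠ σ in 𝓝[>] 0, σ * (ν₁ σ).real Set.univ + σ * (ν₂ σ).real Set.univ ≤ B)
    {f : ℝ → ℂ} {C L : ℝ} (hC : ∀ x, ‖f x‖ ≤ C) (hL : ∀ x y, ‖f x - f y‖ ≤ L * |x - y|) :
    Tendsto (fun σ : ℝ => (σ : ℂ) * (∫ v, f v * (Real.exp (-σ * |v|) : ℂ) ∂ν₁ σ -
      ∫ v, f v * (Real.exp (-σ * |v|) : ℂ) ∂ν₂ σ)) (𝓝[>] 0) (𝓝 0) := by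
  have hC0 : 0 ≤ C := (norm_nonneg _).trans (hC 0)
  have hL0 : 0 ≤ L := by simpa using (norm_nonneg _).trans (hL 0 1)
  have hfc : Continuous f := continuous_of_norm_sub_le hL
  have hB0 : 0 ≤ B := by
    obtain ⟨σ, hσ, hσ0⟩ := (hB.and self_mem_nhdsWithin).exists
    have hσ0 : 0 < σ := hσ0
    exact le_trans (by positivity) hσ
  rw [Metric.tendsto_nhds]
  intro ε hε
  -- Chosen so that smoothing costs at most `ε/2`: the error is `(L + C) η` times the total masses,
  -- which after multiplication by `σ` are at most `B`.
  set η := ε / (2 * ((L + C) * B + 1)) with hη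
  have hη0 : 0 < η := by positivity
  obtain ⟨χ, φ, hχc, hχs, hφc, hφ, hφ1, hφ2, hφ3, hφχ⟩ := exists_bandlimited_kernel hη0
  have hχi : Integrable χ := hχc.integrable_of_hasCompactSupport hχs
  have hG0 : Continuous fun t => G 0 t :=
    continuousOn_univ.1 (hG.comp (f := fun t => ((0 : ℝ), t)) (by fun_prop) (by simp [Set.MapsTo]))
  have hGσ : ∀ σ, 0 < σ → Continuous fun t => G σ t := fun σ hσ =>
    continuousOn_univ.1 (hG.comp (f := fun t => (σ, t)) (by fun_prop)
      (by simp [Set.MapsTo, hσ.le]))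
  have hχG : ∀ {g : ℝ → ℂ}, Continuous g → Integrable fun t => χ t * g t := fun hg =>
    (hχc.mul hg).integrable_of_hasCompactSupport hχs.mul_right
  -- the limiting Fourier integral
  set g₀ : ℝ → ℂ := fun u => ∫ t, χ t * addExp (t * u) * G 0 t with hg₀
  have hg₀c : Continuous g₀ := by
    refine continuous_of_dominated (bound := fun t => ‖χ t * G 0 t‖)
      (fun u => Continuous.aestronglyMeasurable (by fun_prop))
      (fun u => ae_of_all _ fun t => by simp) (hχG hG0).norm
      (ae_of_all _ fun t => by fun_prop)
  have hg₀b : ∀ u, |‖g₀ u‖| ≤ ∫ t, ‖χ t * G 0 t‖ := fun u => by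
    rw [abs_norm]
    refine (norm_integral_le_integral_norm _).trans_eq ?_
    simp
  -- Riemann–Lebesgue lemma; the reflection adjusts the sign convention.
  have hg₀0 : Tendsto (fun u => ‖g₀ u‖) (cocompact ℝ) (𝓝 0) := by
    have h := Real.tendsto_integral_exp_smul_cocompact fun t => χ t * G 0 t
    have hneg : Tendsto (fun u : ℝ => -u) (cocompact ℝ) (cocompact ℝ) :=
      (Homeomorph.neg ℝ).isClosedEmbedding.tendsto_cocompact
    have h2 := (h.comp hneg).norm
    rw [norm_zero] at h2
    refine h2.congr fun u => ?_
    simp only [Function.comp_apply, hg₀]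
    congr 2
    funext t
    rw [fourierChar_smul, mul_neg, neg_neg]
    ring
  -- the error in the Fourier integral
  set δ : ℝ → ℝ := fun σ => ∫ t, ‖χ t‖ * ‖G σ t - G 0 t‖ with hδ
  have hδ0 : Tendsto δ (𝓝[>] 0) (𝓝 0) := by
    -- `G` is bounded on this compact set, which supplies the dominating function.
    have hK : IsCompact (Set.Icc (0 : ℝ) 1 ×ˢ tsupport χ) := isCompact_Icc.prod hχs
    obtain ⟨M, hM⟩ := hK.exists_bound_of_continuousOn
      (hG.mono (Set.prod_mono Set.Icc_subset_Ici_self (Set.subset_univ _)))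
    suffices h : Tendsto δ (𝓝[>] 0) (𝓝 (∫ t : ℝ, ‖χ t‖ * ‖(0 : ℂ)‖)) by simpa using h
    refine tendsto_integral_filter_of_dominated_convergence (fun t => ‖χ t‖ * (M + M)) ?_ ?_
      (hχi.norm.mul_const _) (ae_of_all _ fun t => ?_)
    · filter_upwards [self_mem_nhdsWithin] with σ hσ
      have := hGσ σ hσ
      exact Continuous.aestronglyMeasurable (by fun_prop)
    · filter_upwards [Ioo_mem_nhdsGT one_pos] with σ hσ
      refine ae_of_all _ fun t => ?_
      rw [norm_mul, norm_norm, norm_norm]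
      by_cases ht : t ∈ tsupport χ
      · gcongr
        refine (norm_sub_le _ _).trans (add_le_add (hM (σ, t) ⟨⟨hσ.1.le, hσ.2.le⟩, ht⟩)
          (hM (0, t) ⟨⟨le_rfl, zero_le_one⟩, ht⟩))
      · simp [image_eq_zero_of_notMem_tsupport ht]
    · refine Tendsto.const_mul _ (Tendsto.norm ?_)
      simpa using (tendsto_of_continuousOn_uncurry hG t).sub_const (G 0 t)
  set I := ∫ y : ℝ, Real.exp (-|y|) with hI
  -- The first term is an Abel mean of a function vanishing at infinity; the second is the cost of
  -- replacing `G σ` by `G 0`.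
  have hmain : Tendsto (fun σ : ℝ => C * (σ * ∫ u, Real.exp (-σ * |u|) * ‖g₀ u‖) + C * (δ σ * I))
      (𝓝[>] 0) (𝓝 0) := by
    simpa using ((tendsto_abel_mean_zero hg₀c.norm hg₀b hg₀0).const_mul C).add
      ((hδ0.mul_const I).const_mul C)
  filter_upwards [hB, hmain.eventually_lt_const (half_pos hε), Ioo_mem_nhdsGT one_pos]
    with σ hσB hσm hσ01
  have hσ : 0 < σ := hσ01.1
  have := h₁ σ hσ
  have := h₂ σ hσ
  set k : ℝ → ℂ := fun v => f v * (Real.exp (-σ * |v|) : ℂ) with hk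
  have hkc : Continuous k := by fun_prop
  have hknorm : ∀ u, ‖k u‖ ≤ C * Real.exp (-σ * |u|) := fun u => by
    rw [hk]
    simp only
    rw [norm_mul, Complex.norm_real, Real.norm_of_nonneg (Real.exp_pos _).le]
    gcongr
    exact hC u
  have hkb : ∀ u, ‖k u‖ ≤ C := fun u => (hknorm u).trans <| by
    have : Real.exp (-σ * |u|) ≤ 1 := Real.exp_le_one_iff.2 (by nlinarith [abs_nonneg u])
    nlinarith
  have hei := integrable_exp_neg_mul_abs hσ
  have hki : Integrable k :=
    (hei.const_mul C).mono' hkc.aestronglyMeasurable (ae_of_all _ hknorm)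
  have hkL := norm_damped_sub_le hC hL hσ hσ01.2.le
  have e₁ := norm_integral_smoothing_sub_le hφ hφc hφ1 hφ2 hφ3 hkc hkb hkL (ν₁ σ)
  have e₂ := norm_integral_smoothing_sub_le hφ hφc hφ1 hφ2 hφ3 hkc hkb hkL (ν₂ σ)
  set S₁ := ∫ v, (∫ u, k u * φ (u - v)) ∂ν₁ σ with hS₁
  set S₂ := ∫ v, (∫ u, k u * φ (u - v)) ∂ν₂ σ with hS₂
  have hmF : ∀ (ν : Measure ℝ) [IsFiniteMeasure ν], Continuous (measFourier ν) := by
    intro ν _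
    refine continuous_of_dominated (bound := fun _ => 1)
      (fun u => Continuous.aestronglyMeasurable (by fun_prop))
      (fun u => ae_of_all _ fun t => by simp) (integrable_const _)
      (ae_of_all _ fun t => by fun_prop)
  have hgb : ∀ (ν : Measure ℝ) [IsFiniteMeasure ν],
      Integrable fun u => k u * ∫ t, χ t * addExp (t * u) * measFourier ν t := by
    intro ν _
    have hm := hmF ν
    refine (hki.norm.mul_const (∫ t, ‖χ t * measFourier ν t‖)).mono' ?_ (ae_of_all _ fun u => ?_)
    · refine (hkc.mul ?_).aestronglyMeasurable
      refine continuous_of_dominated (bound := fun t => ‖χ t * measFourier ν t‖)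
        (fun u => Continuous.aestronglyMeasurable (by fun_prop))
        (fun u => ae_of_all _ fun t => by simp) (hχG hm).norm
        (ae_of_all _ fun t => by fun_prop)
    · rw [norm_mul]
      gcongr
      refine (norm_integral_le_integral_norm _).trans_eq ?_
      simp
  have hS : S₁ - S₂ = ∫ u, k u * ∫ t, χ t * addExp (t * u) * G σ t := by
    rw [hS₁, hS₂, integral_smoothing_eq _ hχi hφc hφχ hkc hki,
      integral_smoothing_eq _ hχi hφc hφχ hkc hki, ← integral_sub (hgb _) (hgb _)]
    refine integral_congr_ae (ae_of_all _ fun u => ?_)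
    simp only
    have h1 := hmF (ν₁ σ)
    have h2 := hmF (ν₂ σ)
    rw [← mul_sub, ← integral_sub]
    · simp_rw [← hFT σ hσ, mul_sub]
    · simp_rw [mul_assoc]; exact hχG (by fun_prop)
    · simp_rw [mul_assoc]; exact hχG (by fun_prop)
  have hgσ : ∀ u, ‖∫ t, χ t * addExp (t * u) * G σ t‖ ≤ ‖g₀ u‖ + δ σ := by
    intro u
    have hc := hGσ σ hσ
    have : ∫ t, χ t * addExp (t * u) * G σ t =
        g₀ u + ∫ t, χ t * addExp (t * u) * (G σ t - G 0 t) := by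
      rw [hg₀]
      simp only
      rw [← integral_add]
      · congr 1; funext t; ring
      · simp_rw [mul_assoc]; exact hχG (by fun_prop)
      · simp_rw [mul_assoc]; exact hχG (by fun_prop)
    rw [this]
    refine (norm_add_le _ _).trans ?_
    gcongr
    refine (norm_integral_le_integral_norm _).trans_eq ?_
    simp [hδ]
  have hSn : σ * ‖S₁ - S₂‖ < ε / 2 := by
    refine lt_of_le_of_lt ?_ hσm
    have hgi : Integrable fun u => Real.exp (-σ * |u|) * ‖g₀ u‖ := by
      refine (hei.mul_const (∫ t, ‖χ t * G 0 t‖)).mono'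
        (Continuous.aestronglyMeasurable (by fun_prop)) (ae_of_all _ fun u => ?_)
      rw [norm_mul, norm_norm, Real.norm_of_nonneg (Real.exp_pos _).le]
      gcongr
      simpa using hg₀b u
    have hb : ‖S₁ - S₂‖ ≤ ∫ u, (C * (Real.exp (-σ * |u|) * ‖g₀ u‖) +
        C * δ σ * Real.exp (-σ * |u|)) := by
      rw [hS]
      refine norm_integral_le_of_norm_le ((hgi.const_mul C).add (hei.const_mul (C * δ σ)))
        (ae_of_all _ fun u => ?_)
      rw [norm_mul]
      calc _ ≤ (C * Real.exp (-σ * |u|)) * (‖g₀ u‖ + δ σ) :=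
            mul_le_mul (hknorm u) (hgσ u) (norm_nonneg _) (by positivity)
        _ = _ := by ring
    rw [integral_add (hgi.const_mul C) (hei.const_mul (C * δ σ)), integral_const_mul,
      integral_const_mul] at hb
    rw [hI, ← integral_exp_neg_mul_abs hσ]
    exact (mul_le_mul_of_nonneg_left hb hσ.le).trans_eq (by ring)
  rw [dist_zero_right, norm_mul, Complex.norm_real, Real.norm_of_nonneg hσ.le]
  have hfin : ‖∫ v, k v ∂ν₁ σ - ∫ v, k v ∂ν₂ σ‖ ≤ ‖S₁ - S₂‖ +
      (L + C) * η * (ν₁ σ).real Set.univ + (L + C) * η * (ν₂ σ).real Set.univ := by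
    have : ∫ v, k v ∂ν₁ σ - ∫ v, k v ∂ν₂ σ =
        (S₁ - S₂) - (S₁ - ∫ v, k v ∂ν₁ σ) + (S₂ - ∫ v, k v ∂ν₂ σ) := by ring
    rw [this]
    refine (norm_add_le _ _).trans (add_le_add ((norm_sub_le _ _).trans ?_) e₂)
    gcongr
  have hηB : (L + C) * η * B ≤ ε / 2 := by
    rw [hη, mul_div_assoc', div_mul_eq_mul_div, div_le_div_iff₀ (by positivity) two_pos]
    nlinarith
  calc σ * ‖∫ v, k v ∂ν₁ σ - ∫ v, k v ∂ν₂ σ‖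
      ≤ σ * (‖S₁ - S₂‖ + (L + C) * η * (ν₁ σ).real Set.univ +
        (L + C) * η * (ν₂ σ).real Set.univ) := by gcongr
    _ = σ * ‖S₁ - S₂‖ + (L + C) * η * (σ * (ν₁ σ).real Set.univ + σ * (ν₂ σ).real Set.univ) := by
      ring
    _ ≤ σ * ‖S₁ - S₂‖ + (L + C) * η * B := by gcongr
    _ < ε := by linarith

/-! ### Primes congruent to one: Abel means against Lipschitz functions -/

section Measures

open ArithmeticFunction vonMangoldt

variable (q : ℕ)

/-- The coefficient `Λ(n) n^{-(1+σ)}`, restricted to `n ≡ 1 mod q`. -/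
noncomputable def mangoldtWeight (σ : ℝ) (n : ℕ) : ℝ :=
  residueClass (1 : ZMod q) n / (n : ℝ) ^ (1 + σ)

/-- The measure placing mass `Λ(n) n^{-(1+σ)}` at `log n`, for `n ≡ 1 mod q`. -/
noncomputable def mangoldtMeasure (σ : ℝ) : Measure ℝ :=
  Measure.sum fun n : ℕ => ENNReal.ofReal (mangoldtWeight q σ n) • Measure.dirac (Real.log n)

/-- The measure with density `φ(q)⁻¹ e^{-σv}` on the positive half-line. -/
noncomputable def expMeasure (σ : ℝ) : Measure ℝ :=
  (volume.restrict (Set.Ioi 0)).withDensity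
    fun v => ENNReal.ofReal ((q.totient : ℝ)⁻¹ * Real.exp (-σ * v))

lemma mangoldtWeight_nonneg (σ : ℝ) (n : ℕ) : 0 ≤ mangoldtWeight q σ n :=
  div_nonneg (residueClass_nonneg _ n) (by positivity)

lemma summable_mangoldtWeight {σ : ℝ} (hσ : 0 < σ) : Summable (mangoldtWeight q σ) := by
  refine LSeries.summable_real_of_abscissaOfAbsConv_lt ?_
  refine (abscissaOfAbsConv_residueClass_le_one _).trans_lt ?_
  exact_mod_cast (by linarith : (1 : ℝ) < 1 + σ)

lemma isFiniteMeasure_mangoldtMeasure {σ : ℝ} (hσ : 0 < σ) :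
    IsFiniteMeasure (mangoldtMeasure q σ) := by
  refine ⟨?_⟩
  rw [mangoldtMeasure, Measure.sum_apply _ MeasurableSet.univ]
  simp only [Measure.smul_apply, measure_univ, smul_eq_mul, mul_one]
  rw [← ENNReal.ofReal_tsum_of_nonneg (mangoldtWeight_nonneg q σ) (summable_mangoldtWeight q hσ)]
  exact ENNReal.ofReal_lt_top

lemma integral_mangoldtMeasure {σ : ℝ} (hσ : 0 < σ) {f : ℝ → ℂ} (hf : Continuous f) {C : ℝ}
    (hC : ∀ x, ‖f x‖ ≤ C) :
    ∫ v, f v ∂mangoldtMeasure q σ = ∑' n : ℕ, (mangoldtWeight q σ n : ℂ) * f (Real.log n) := by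
  have := isFiniteMeasure_mangoldtMeasure q hσ
  have hi : Integrable f (mangoldtMeasure q σ) :=
    (integrable_const C).mono' hf.aestronglyMeasurable (ae_of_all _ hC)
  rw [mangoldtMeasure] at hi ⊢
  rw [integral_sum_measure hi]
  refine tsum_congr fun n => ?_
  rw [integral_smul_measure, integral_dirac, ENNReal.toReal_ofReal (mangoldtWeight_nonneg q σ n),
    Complex.real_smul]

lemma isFiniteMeasure_expMeasure {σ : ℝ} (hσ : 0 < σ) : IsFiniteMeasure (expMeasure q σ) := by
  refine isFiniteMeasure_withDensity_ofReal ?_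
  exact ((integrableOn_exp_mul_Ioi (neg_lt_zero.2 hσ) 0).const_mul _).hasFiniteIntegral

lemma integral_expMeasure (σ : ℝ) (f : ℝ → ℂ) :
    ∫ v, f v ∂expMeasure q σ =
      (q.totient : ℂ)⁻¹ * ∫ v in Set.Ioi 0, (Real.exp (-σ * v) : ℂ) * f v := by
  rw [expMeasure, integral_withDensity_eq_integral_toReal_smul (by fun_prop)
    (ae_of_all _ fun _ => ENNReal.ofReal_lt_top), ← integral_const_mul]
  refine integral_congr_ae (ae_of_all _ fun v => ?_)
  simp only
  rw [ENNReal.toReal_ofReal (by positivity), Complex.real_smul]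
  push_cast
  ring

/-- A mass at `log n` contributes `e(-t log n) = n^{-2πit}`, so the transform is a Dirichlet series
on a vertical line. -/
lemma measFourier_mangoldtMeasure {σ : ℝ} (hσ : 0 < σ) (t : ℝ) :
    measFourier (mangoldtMeasure q σ) t =
      LSeries (fun n => (residueClass (1 : ZMod q) n : ℂ)) (1 + σ + 2 * Real.pi * t * Complex.I) := by
  rw [measFourier, integral_mangoldtMeasure q hσ (C := 1) (by fun_prop) (by simp), LSeries]
  refine tsum_congr fun n => ?_
  rcases eq_or_ne n 0 with rfl | hn
  · simp [mangoldtWeight]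
  have hn0 : (n : ℂ) ≠ 0 := by exact_mod_cast hn
  have hn1 : (0 : ℝ) ≤ n := n.cast_nonneg
  have e : (n : ℂ) ^ (1 + σ + 2 * Real.pi * t * Complex.I : ℂ) =
      (((n : ℝ) ^ (1 + σ) : ℝ) : ℂ) * Complex.exp (2 * Real.pi * t * Complex.I * Real.log n) := by
    rw [Complex.cpow_add _ _ hn0, Complex.ofReal_cpow hn1]
    push_cast
    congr 1
    rw [Complex.cpow_def_of_ne_zero hn0]
    ring_nf
  rw [LSeries.term_of_ne_zero hn, e, mangoldtWeight, addExp, div_mul_eq_div_div, div_eq_mul_inv _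
    (Complex.exp _), ← Complex.exp_neg]
  push_cast
  congr 2
  ring

lemma measFourier_expMeasure {σ : ℝ} (hσ : 0 < σ) (t : ℝ) :
    measFourier (expMeasure q σ) t =
      (q.totient : ℂ)⁻¹ / ((1 + σ + 2 * Real.pi * t * Complex.I : ℂ) - 1) := by
  rw [measFourier, integral_expMeasure]
  have h := integral_exp_mul_complex_Ioi (a := -(σ + 2 * Real.pi * t * Complex.I))
    (by simpa using hσ) 0
  have e : ∀ v : ℝ, (Real.exp (-σ * v) : ℂ) * addExp (-(t * v)) =
      Complex.exp (-(σ + 2 * Real.pi * t * Complex.I) * v) := fun v => by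
    rw [addExp, Complex.ofReal_exp, ← Complex.exp_add]
    push_cast
    ring_nf
  simp_rw [e, h]
  rw [Complex.ofReal_zero, mul_zero, Complex.exp_zero, neg_div_neg_eq, mul_one_div]
  ring_nf

/-! ### Passage from von Mangoldt weights to prime weights -/

variable {f : ℝ → ℂ} {C L : ℝ}

/-- The coefficient `log p · p^{-(1+2σ)}` at the primes `p ≡ 1 mod q`. -/
noncomputable def primeWeight (σ : ℝ) (n : ℕ) : ℝ :=
  if n.Prime then mangoldtWeight q (2 * σ) n else 0

lemma primeWeight_nonneg (σ : ℝ) (n : ℕ) : 0 ≤ primeWeight q σ n := by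
  unfold primeWeight
  split_ifs
  exacts [mangoldtWeight_nonneg q _ n, le_rfl]

lemma summable_primeWeight {σ : ℝ} (hσ : 0 < σ) : Summable (primeWeight q σ) := by
  refine (summable_mangoldtWeight q (by positivity : 0 < 2 * σ)).of_nonneg_of_le
    (primeWeight_nonneg q σ) fun n => ?_
  unfold primeWeight
  split_ifs
  exacts [le_rfl, mangoldtWeight_nonneg q _ n]

lemma summable_mul_of_bounded {w : ℕ → ℝ} (hw : Summable w) (hw0 : ∀ n, 0 ≤ w n) {g : ℕ → ℂ}
    (hg : ∀ n, ‖g n‖ ≤ C) : Summable fun n => (w n : ℂ) * g n := by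
  refine Summable.of_norm_bounded (hw.mul_right C) fun n => ?_
  rw [norm_mul, Complex.norm_real, Real.norm_of_nonneg (hw0 n)]
  exact mul_le_mul_of_nonneg_left (hg n) (hw0 n)

/-- `∑ Λ(n)/n` over non-primes in the class converges, so the factor `σ` kills their contribution.
-/
lemma tendsto_nonprime_abel (hC : ∀ x, ‖f x‖ ≤ C) :
    Tendsto (fun σ : ℝ => (σ : ℂ) * (∑' n : ℕ, (mangoldtWeight q (2 * σ) n : ℂ) * f (Real.log n) -
      ∑' n : ℕ, (primeWeight q σ n : ℂ) * f (Real.log n))) (𝓝[>] 0) (𝓝 0) := by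
  have hC0 : 0 ≤ C := (norm_nonneg _).trans (hC 0)
  have hs := summable_residueClass_non_primes_div (1 : ZMod q)
  set S := ∑' n : ℕ, (if n.Prime then 0 else residueClass (1 : ZMod q) n) / (n : ℝ) * C with hS
  have h4 : Tendsto (fun σ : ℝ => σ * S) (𝓝[>] 0) (𝓝 0) := by
    have : Tendsto (fun σ : ℝ => σ * S) (𝓝 0) (𝓝 (0 * S)) := tendsto_id.mul_const S
    rw [zero_mul] at this
    exact this.mono_left nhdsWithin_le_nhds
  refine squeeze_zero_norm' ?_ h4
  filter_upwards [self_mem_nhdsWithin] with σ hσ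
  have hσ : 0 < σ := hσ
  rw [norm_mul, Complex.norm_real, Real.norm_of_nonneg hσ.le]
  gcongr
  rw [← Summable.tsum_sub (summable_mul_of_bounded (summable_mangoldtWeight q (by positivity))
    (mangoldtWeight_nonneg q _) fun n => hC _) (summable_mul_of_bounded (summable_primeWeight q hσ)
    (primeWeight_nonneg q _) fun n => hC _)]
  refine tsum_of_norm_bounded (hs.mul_right C).hasSum fun n => ?_
  rw [← sub_mul, norm_mul, ← Complex.ofReal_sub, Complex.norm_real]
  refine mul_le_mul ?_ (hC _) (norm_nonneg _) ?_
  · unfold primeWeight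
    split_ifs with hp
    · simp
    · rw [sub_zero, Real.norm_of_nonneg (mangoldtWeight_nonneg q _ n), mangoldtWeight]
      rcases eq_or_ne n 0 with rfl | hn
      · simp
      gcongr
      · exact residueClass_nonneg _ _
      · exact Real.self_le_rpow_of_one_le (by exact_mod_cast Nat.one_le_iff_ne_zero.2 hn)
          (by linarith)
  · refine div_nonneg ?_ n.cast_nonneg
    split_ifs
    exacts [le_rfl, residueClass_nonneg _ _]

/-- The Abel mean of `f` over the logarithms of primes `p ≡ 1 mod q`. -/
noncomputable def primeAbel (f : ℝ → ℂ) (σ : ℝ) : ℂ :=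
  σ * ∑' n : ℕ, (primeWeight q σ n : ℂ) * f (Real.log n)

variable [NeZero q]

/-- The boundary function in the Tauberian theorem. -/
noncomputable def boundaryFun (σ t : ℝ) : ℂ :=
  LFunctionResidueClassAux (1 : ZMod q) (1 + σ + 2 * Real.pi * t * Complex.I)

/-- The arithmetic input: with the pole at `s = 1` removed, the series extends continuously to `Re s
≥ 1`, which rests on the non-vanishing of Dirichlet `L`-functions there. -/
lemma continuousOn_boundaryFun :
    ContinuousOn (Function.uncurry (boundaryFun q)) (Set.Ici 0 ×ˢ Set.univ) := by
  refine (continuousOn_LFunctionResidueClassAux (1 : ZMod q)).comp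
    (f := fun z : ℝ × ℝ => (1 + z.1 + 2 * Real.pi * z.2 * Complex.I : ℂ)) (by fun_prop) ?_
  rintro ⟨σ, t⟩ ⟨hσ, _⟩
  simpa using hσ

lemma measFourier_sub_eq_boundaryFun {σ : ℝ} (hσ : 0 < σ) (t : ℝ) :
    measFourier (mangoldtMeasure q σ) t - measFourier (expMeasure q σ) t = boundaryFun q σ t := by
  rw [measFourier_mangoldtMeasure q hσ, measFourier_expMeasure q hσ, boundaryFun]
  exact (eqOn_LFunctionResidueClassAux (q := q) isUnit_one (by simpa using hσ)).symm

lemma measFourier_zero (ν : Measure ℝ) : measFourier ν 0 = (ν.real Set.univ : ℂ) := by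
  simp [measFourier]

/-- At `t = 0` the masses differ by `boundaryFun q σ 0`, bounded as `σ → 0`, while `σ` times the
mass of `expMeasure` is exactly `1/φ(q)`. -/
lemma eventually_mass_le : ∀ᶠ σ in 𝓝[>] (0 : ℝ), σ * (mangoldtMeasure q σ).real Set.univ +
    σ * (expMeasure q σ).real Set.univ ≤ 2 * (q.totient : ℝ)⁻¹ + 1 := by
  have h1 := tendsto_of_continuousOn_uncurry (continuousOn_boundaryFun q) 0
  have h3 : Tendsto (fun σ : ℝ => σ * ‖boundaryFun q σ 0‖) (𝓝[>] 0) (𝓝 0) := by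
    have h4 : Tendsto (fun σ : ℝ => σ) (𝓝[>] 0) (𝓝 0) :=
      tendsto_id.mono_left nhdsWithin_le_nhds
    simpa using h4.mul h1.norm
  filter_upwards [h3.eventually_le_const one_pos, self_mem_nhdsWithin] with σ h hσ
  have hσ : 0 < σ := hσ
  have e1 := measFourier_sub_eq_boundaryFun q hσ 0
  have e2 := measFourier_expMeasure q hσ 0
  rw [measFourier_zero] at e1 e2
  rw [measFourier_zero] at e1
  have e3 : (expMeasure q σ).real Set.univ = (q.totient : ℝ)⁻¹ / σ := by
    have : (((expMeasure q σ).real Set.univ : ℝ) : ℂ) = (((q.totient : ℝ)⁻¹ / σ : ℝ) : ℂ) := by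
      rw [e2]; push_cast; congr 1; ring
    exact_mod_cast this
  have e4 : (mangoldtMeasure q σ).real Set.univ - (expMeasure q σ).real Set.univ ≤
      ‖boundaryFun q σ 0‖ := by
    rw [← e1, ← Complex.ofReal_sub, Complex.norm_real]
    exact le_abs_self _
  rw [e3] at e4 ⊢
  have e5 : σ * ((q.totient : ℝ)⁻¹ / σ) = (q.totient : ℝ)⁻¹ := by field_simp
  have e6 := mul_le_mul_of_nonneg_left e4 hσ.le
  rw [mul_sub, e5] at e6
  rw [e5]
  linarith

lemma tendsto_mangoldt_abel (hC : ∀ x, ‖f x‖ ≤ C) (hL : ∀ x y, ‖f x - f y‖ ≤ L * |x - y|) :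
    Tendsto (fun σ : ℝ => (σ : ℂ) * (∑' n : ℕ, (mangoldtWeight q (2 * σ) n : ℂ) * f (Real.log n) -
      (q.totient : ℂ)⁻¹ * ∫ v in Set.Ioi 0, (Real.exp (-(2 * σ) * v) : ℂ) * f v))
      (𝓝[>] 0) (𝓝 0) := by
  have hfc := continuous_of_norm_sub_le hL
  have hC0 : 0 ≤ C := (norm_nonneg _).trans (hC 0)
  refine (tendsto_abel_mean_sub (fun σ hσ => isFiniteMeasure_mangoldtMeasure q hσ)
    (fun σ hσ => isFiniteMeasure_expMeasure q hσ) (continuousOn_boundaryFun q)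
    (fun σ hσ t => measFourier_sub_eq_boundaryFun q hσ t) (eventually_mass_le q) hC hL).congr' ?_
  filter_upwards [self_mem_nhdsWithin] with σ hσ
  have hσ : 0 < σ := hσ
  rw [integral_mangoldtMeasure q hσ (C := C) (by fun_prop), integral_expMeasure]
  · congr 2
    · refine tsum_congr fun n => ?_
      rcases eq_or_ne n 0 with rfl | hn
      · simp [mangoldtWeight]
      have hn0 : (0 : ℝ) < n := by exact_mod_cast Nat.pos_of_ne_zero hn
      have hlog : 0 ≤ Real.log n := Real.log_natCast_nonneg n
      rw [abs_of_nonneg hlog]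
      -- Of the exponent `2σ`, one `σ` makes the measures finite and the other is the damping that
      -- makes the test function integrable.
      have : mangoldtWeight q (2 * σ) n = mangoldtWeight q σ n * Real.exp (-σ * Real.log n) := by
        rw [mangoldtWeight, mangoldtWeight, show 1 + 2 * σ = (1 + σ) + σ by ring,
          Real.rpow_add hn0 (1 + σ), Real.rpow_def_of_pos hn0 σ, div_mul_eq_div_div,
          div_eq_mul_inv _ (Real.exp _), ← Real.exp_neg]
        ring_nf
      rw [this]
      push_cast
      ring
    · congr 1
      refine setIntegral_congr_fun measurableSet_Ioi fun v hv => ?_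
      rw [abs_of_pos (Set.mem_Ioi.1 hv), show -(2 * σ) * v = -σ * v + -σ * v by ring, Real.exp_add]
      push_cast
      ring
  · intro x
    rw [norm_mul, Complex.norm_real, Real.norm_of_nonneg (Real.exp_pos _).le]
    have : Real.exp (-σ * |x|) ≤ 1 := Real.exp_le_one_iff.2 (by nlinarith [abs_nonneg x])
    calc _ ≤ C * 1 := mul_le_mul (hC x) this (Real.exp_pos _).le hC0
      _ = C := mul_one C

lemma tendsto_primeAbel_sub (hC : ∀ x, ‖f x‖ ≤ C) (hL : ∀ x y, ‖f x - f y‖ ≤ L * |x - y|) :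
    Tendsto (fun σ : ℝ => primeAbel q f σ -
      (q.totient : ℂ)⁻¹ * (σ * ∫ v in Set.Ioi 0, (Real.exp (-(2 * σ) * v) : ℂ) * f v))
      (𝓝[>] 0) (𝓝 0) := by
  have h := (tendsto_mangoldt_abel q hC hL).sub (tendsto_nonprime_abel q hC)
  rw [sub_zero] at h
  refine h.congr fun σ => ?_
  rw [primeAbel]
  ring

lemma integrableOn_exp_mul_bounded {σ : ℝ} (hσ : 0 < σ) (hf : Continuous f) (hC : ∀ x, ‖f x‖ ≤ C)
    (a : ℝ) : IntegrableOn (fun v : ℝ => (Real.exp (-(2 * σ) * v) : ℂ) * f v) (Set.Ioi a) := by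
  refine ((integrableOn_exp_mul_Ioi (by linarith : -(2 * σ) < 0) a).mul_const C).mono'
    (Continuous.aestronglyMeasurable (by fun_prop)) (ae_of_all _ fun v => ?_)
  rw [norm_mul, Complex.norm_real, Real.norm_of_nonneg (Real.exp_pos _).le]
  exact mul_le_mul_of_nonneg_left (hC v) (Real.exp_pos _).le

lemma norm_mul_laplace_le {σ : ℝ} (hσ : 0 < σ) (hC : ∀ x, ‖f x‖ ≤ C) :
    ‖(σ : ℂ) * ∫ v in Set.Ioi 0, (Real.exp (-(2 * σ) * v) : ℂ) * f v‖ ≤ C := by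
  have hC0 : 0 ≤ C := (norm_nonneg _).trans (hC 0)
  have h1 := norm_integral_le_of_norm_le (μ := volume.restrict (Set.Ioi (0 : ℝ)))
    (f := fun v : ℝ => (Real.exp (-(2 * σ) * v) : ℂ) * f v)
    ((integrableOn_exp_mul_Ioi (by linarith : -(2 * σ) < 0) 0).mul_const C)
    (ae_of_all _ fun v => by
      rw [norm_mul, Complex.norm_real, Real.norm_of_nonneg (Real.exp_pos _).le]
      exact mul_le_mul_of_nonneg_left (hC v) (Real.exp_pos _).le)
  rw [integral_mul_const, integral_exp_mul_Ioi (by linarith : -(2 * σ) < 0)] at h1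
  rw [norm_mul, Complex.norm_real, Real.norm_of_nonneg hσ.le]
  calc _ ≤ σ * (-Real.exp (-(2 * σ) * 0) / -(2 * σ) * C) := by gcongr
    _ = C / 2 := by rw [mul_zero, Real.exp_zero]; field_simp
    _ ≤ C := by linarith

/-- A translation multiplies the integral by `e^{2σb}` and changes its domain by a bounded interval;
both effects vanish after multiplication by `σ`. -/
lemma tendsto_laplace_translate (hf : Continuous f) (hC : ∀ x, ‖f x‖ ≤ C) (b : ℝ) :
    Tendsto (fun σ : ℝ => (σ : ℂ) * (∫ v in Set.Ioi 0, (Real.exp (-(2 * σ) * v) : ℂ) * f (v + b)) -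
      σ * ∫ v in Set.Ioi 0, (Real.exp (-(2 * σ) * v) : ℂ) * f v) (𝓝[>] 0) (𝓝 0) := by
  have hC0 : 0 ≤ C := (norm_nonneg _).trans (hC 0)
  have hlim : Tendsto (fun σ : ℝ => |Real.exp (2 * σ * b) - 1| * C +
      σ * Real.exp (2 * σ * b) * (Real.exp (2 * |b|) * C * |b|)) (𝓝[>] 0) (𝓝 0) := by
    have : Continuous (fun σ : ℝ => |Real.exp (2 * σ * b) - 1| * C +
      σ * Real.exp (2 * σ * b) * (Real.exp (2 * |b|) * C * |b|)) := by fun_prop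
    have h := this.tendsto 0
    simp only [mul_zero, zero_mul, Real.exp_zero, sub_self, abs_zero, add_zero] at h
    exact h.mono_left nhdsWithin_le_nhds
  refine squeeze_zero_norm' ?_ hlim
  filter_upwards [Ioo_mem_nhdsGT one_pos] with σ hσ01
  have hσ := hσ01.1
  set g : ℝ → ℂ := fun v => (Real.exp (-(2 * σ) * v) : ℂ) * f v with hg
  have h1 : ∫ v in Set.Ioi 0, (Real.exp (-(2 * σ) * v) : ℂ) * f (v + b) =
      (Real.exp (2 * σ * b) : ℂ) * ∫ v in Set.Ioi b, g v := by
    have h := (measurePreserving_add_right volume b).setIntegral_preimage_emb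
      (measurableEmbedding_addRight b) g (Set.Ioi b)
    rw [← h, ← integral_const_mul]
    simp only [Set.preimage_add_const_Ioi, sub_self]
    refine integral_congr_ae (ae_of_all _ fun v => ?_)
    simp only [hg]
    rw [← mul_assoc, ← Complex.ofReal_mul, ← Real.exp_add]
    ring_nf
  have h2 : (∫ v in Set.Ioi b, g v) - ∫ v in Set.Ioi 0, g v = ∫ v in b..0, g v :=
    intervalIntegral.integral_Ioi_sub_Ioi' (integrableOn_exp_mul_bounded hσ hf hC b)
    (integrableOn_exp_mul_bounded hσ hf hC 0)
  have h3 : ‖∫ v in b..0, g v‖ ≤ Real.exp (2 * |b|) * C * |b| := by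
    have := intervalIntegral.norm_integral_le_of_norm_le_const (a := b) (b := 0) (f := g)
      (C := Real.exp (2 * |b|) * C) fun v hv => by
        rw [hg]
        simp only
        rw [norm_mul, Complex.norm_real, Real.norm_of_nonneg (Real.exp_pos _).le]
        refine mul_le_mul (Real.exp_le_exp.2 ?_) (hC v) (norm_nonneg _) (Real.exp_pos _).le
        have hv' : |v| ≤ |b| := by
          rcases Set.mem_uIoc.1 hv with h | h
          · rw [abs_of_nonpos h.2, abs_of_nonpos (h.1.le.trans h.2)]; linarith [h.1]
          · rw [abs_of_pos h.1, abs_of_pos (h.1.trans_le h.2)]; exact h.2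
        have := neg_abs_le v
        nlinarith [abs_nonneg v, hσ01.2]
    simpa using this
  have h4 : (σ : ℂ) * (∫ v in Set.Ioi 0, (Real.exp (-(2 * σ) * v) : ℂ) * f (v + b)) -
      σ * ∫ v in Set.Ioi 0, g v = ((Real.exp (2 * σ * b) - 1 : ℝ) : ℂ) *
        (σ * ∫ v in Set.Ioi 0, g v) +
        ((σ * Real.exp (2 * σ * b) : ℝ) : ℂ) * ∫ v in b..0, g v := by
    rw [h1, ← h2]
    push_cast
    ring
  rw [h4]
  refine (norm_add_le _ _).trans (add_le_add ?_ ?_)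
  · rw [norm_mul, Complex.norm_real, Real.norm_eq_abs]
    exact mul_le_mul_of_nonneg_left (norm_mul_laplace_le hσ hC) (abs_nonneg _)
  · rw [norm_mul, Complex.norm_real, Real.norm_of_nonneg (by positivity)]
    gcongr

lemma tendsto_primeAbel_translate (hC : ∀ x, ‖f x‖ ≤ C) (hL : ∀ x y, ‖f x - f y‖ ≤ L * |x - y|)
    (b : ℝ) :
    Tendsto (fun σ : ℝ => primeAbel q (fun x => f (x + b)) σ - primeAbel q f σ)
      (𝓝[>] 0) (𝓝 0) := by
  have h1 := tendsto_primeAbel_sub q hC hL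
  have h2 := tendsto_primeAbel_sub q (f := fun x => f (x + b)) (fun x => hC _)
    (fun x y => by simpa using hL (x + b) (y + b))
  have h3 := (tendsto_laplace_translate (continuous_of_norm_sub_le hL) hC b).const_mul
    (q.totient : ℂ)⁻¹
  have h4 := (h2.sub h1).add h3
  simp only [mul_zero, sub_zero, add_zero] at h4
  refine h4.congr fun σ => ?_
  ring

lemma tendsto_primeAbel_one :
    Tendsto (primeAbel q fun _ => 1) (𝓝[>] 0) (𝓝 ((q.totient : ℂ)⁻¹ / 2)) := by
  have h1 := tendsto_primeAbel_sub q (f := fun _ => 1) (C := 1) (L := 0) (by simp) (by simp)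
  have h2 : Tendsto (fun σ : ℝ => (q.totient : ℂ)⁻¹ *
      (σ * ∫ v in Set.Ioi (0 : ℝ), (Real.exp (-(2 * σ) * v) : ℂ) * 1)) (𝓝[>] 0)
      (𝓝 ((q.totient : ℂ)⁻¹ / 2)) := by
    refine tendsto_const_nhds.congr' ?_
    filter_upwards [self_mem_nhdsWithin] with σ hσ
    have hσ : 0 < σ := hσ
    simp only [mul_one]
    rw [integral_complex_ofReal, integral_exp_mul_Ioi (by linarith : -(2 * σ) < 0)]
    have : (σ : ℂ) ≠ 0 := by exact_mod_cast hσ.ne'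
    rw [mul_zero, Real.exp_zero]
    push_cast
    field_simp
  simpa using h1.add h2

end Measures

/-! ### Limits of averages along ultrafilters -/

lemma realAvg_congr {u u' : ℕ → ℂ} (h : ∀ n, 1 ≤ n → u n = u' n) (t : ℝ) :
    realAvg u t = realAvg u' t := by
  rw [realAvg, realAvg, Finset.sum_congr rfl fun n hn => h n (Finset.mem_Icc.1 hn).1]

/-- Averages vary slowly in `log t`. The term `C/t`, due to integer parts, disappears in the limit
and leaves a Lipschitz function of `v`. -/
lemma norm_realAvg_sub_le {u : ℕ → ℂ} {C : ℝ} (hu : ∀ n, 1 ≤ n → ‖u n‖ ≤ C) {s t : ℝ}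
    (hs : 0 < s) (hst : s ≤ t) :
    ‖realAvg u t - realAvg u s‖ ≤ 2 * C * Real.log (t / s) + C / t := by
  have hC : 0 ≤ C := (norm_nonneg _).trans (hu 1 le_rfl)
  have ht : 0 < t := hs.trans_le hst
  have hfl : ⌊s⌋₊ ≤ ⌊t⌋₊ := Nat.floor_le_floor hst
  set A := ∑ n ∈ Finset.Icc 1 ⌊s⌋₊, u n with hA
  set B := ∑ n ∈ Finset.Ioc ⌊s⌋₊ ⌊t⌋₊, u n with hB
  have hsum : ∑ n ∈ Finset.Icc 1 ⌊t⌋₊, u n = A + B := by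
    have h1 : ∀ N, Finset.Icc 1 N = Finset.Ioc 0 N := fun N => rfl
    rw [hA, hB, h1, h1, Finset.sum_Ioc_consecutive _ (Nat.zero_le _) hfl]
  have hAn : ‖A‖ ≤ s * C :=
    (sum_Icc_norm_le hu _).trans (by gcongr; exact Nat.floor_le hs.le)
  have hBn : ‖B‖ ≤ (t - s + 1) * C := by
    refine (norm_sum_le_of_le _ fun n hn => hu n ?_).trans ?_
    · exact Nat.one_le_iff_ne_zero.2 (by have := (Finset.mem_Ioc.1 hn).1; omega)
    · rw [Finset.sum_const, Nat.card_Ioc, nsmul_eq_mul, Nat.cast_sub hfl]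
      gcongr
      linarith [Nat.floor_le ht.le, Nat.lt_floor_add_one s]
  have e : realAvg u t - realAvg u s = ((t⁻¹ - s⁻¹ : ℝ) : ℂ) * A + ((t⁻¹ : ℝ) : ℂ) * B := by
    rw [realAvg, realAvg, hsum, ← hA]
    push_cast
    ring
  have h1 : 1 - s / t ≤ Real.log (t / s) := by
    have := Real.one_sub_inv_le_log_of_pos (div_pos ht hs)
    rwa [inv_div] at this
  have h2 : |t⁻¹ - s⁻¹| = s⁻¹ - t⁻¹ := by
    rw [abs_of_nonpos, neg_sub]
    have := inv_anti₀ hs hst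
    linarith
  rw [e]
  calc _ ≤ (s⁻¹ - t⁻¹) * (s * C) + t⁻¹ * ((t - s + 1) * C) := by
        refine (norm_add_le _ _).trans (add_le_add ?_ ?_)
        · rw [norm_mul, Complex.norm_real, Real.norm_eq_abs, h2]
          have := inv_anti₀ hs hst
          exact mul_le_mul_of_nonneg_left hAn (by linarith)
        · rw [norm_mul, Complex.norm_real, Real.norm_of_nonneg (by positivity)]
          gcongr
    _ = 2 * C * (1 - s / t) + C / t := by field_simp; ring
    _ ≤ _ := by gcongr

section LimAvg

variable (U : Ultrafilter ℕ)

/-- The limit along `U` of the averages of `u` up to `N e^{-v}`. -/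
noncomputable def limAvg (u : ℕ → ℂ) (v : ℝ) : ℂ :=
  limUnder (U : Filter ℕ) fun N : ℕ => realAvg u (N * Real.exp (-v))

variable {U} (hU : (U : Filter ℕ) ≤ atTop) {u u₁ : ℕ → ℂ} {C : ℝ}
include hU

lemma tendsto_mul_exp (v : ℝ) : Tendsto (fun N : ℕ => (N : ℝ) * Real.exp (-v)) U atTop :=
  (tendsto_natCast_atTop_atTop.atTop_mul_const (Real.exp_pos _)).mono_left hU

lemma tendsto_limAvg (hu : ∀ n, 1 ≤ n → ‖u n‖ ≤ C) (v : ℝ) :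
    Tendsto (fun N : ℕ => realAvg u (N * Real.exp (-v))) U (𝓝 (limAvg U u v)) := by
  have h1 : ∀ᶠ N : ℕ in U, realAvg u (N * Real.exp (-v)) ∈ Metric.closedBall (0 : ℂ) C := by
    filter_upwards [(tendsto_mul_exp hU v).eventually_gt_atTop 0] with N hN
    rw [mem_closedBall_zero_iff]
    exact realAvg_norm_le hu hN
  obtain ⟨x, -, hx⟩ := (isCompact_closedBall (0 : ℂ) C).ultrafilter_le_nhds
    (U.map fun N : ℕ => realAvg u (N * Real.exp (-v))) (le_principal_iff.2 h1)
  exact tendsto_nhds_limUnder ⟨x, hx⟩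

lemma norm_limAvg_le (hu : ∀ n, 1 ≤ n → ‖u n‖ ≤ C) (v : ℝ) : ‖limAvg U u v‖ ≤ C := by
  refine le_of_tendsto (tendsto_limAvg hU hu v).norm ?_
  filter_upwards [(tendsto_mul_exp hU v).eventually_gt_atTop 0] with N hN
  exact realAvg_norm_le hu hN

lemma norm_limAvg_sub_le (hu : ∀ n, 1 ≤ n → ‖u n‖ ≤ C) (x y : ℝ) :
    ‖limAvg U u x - limAvg U u y‖ ≤ 2 * C * |x - y| := by
  wlog hxy : x ≤ y generalizing x y
  · rw [norm_sub_rev, abs_sub_comm]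
    exact this y x (le_of_not_ge hxy)
  have h1 := ((tendsto_limAvg hU hu x).sub (tendsto_limAvg hU hu y)).norm
  have h2 : Tendsto (fun N : ℕ => 2 * C * |x - y| + C / (N * Real.exp (-x))) U
      (𝓝 (2 * C * |x - y| + 0)) :=
    ((tendsto_mul_exp hU x).const_div_atTop C).const_add _
  rw [add_zero] at h2
  refine le_of_tendsto_of_tendsto h1 h2 ?_
  filter_upwards [hU (eventually_gt_atTop 0)] with N hN
  have hN : (0 : ℝ) < N := by exact_mod_cast hN
  refine (norm_realAvg_sub_le hu (by positivity)
    (mul_le_mul_of_nonneg_left (Real.exp_le_exp.2 (neg_le_neg hxy)) hN.le)).trans_eq ?_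
  rw [mul_div_mul_left _ _ hN.ne', ← Real.exp_sub, Real.log_exp, abs_sub_comm,
    abs_of_nonneg (by linarith)]
  ring_nf

lemma limAvg_turan_kubilius (hu : ∀ n, 1 ≤ n → ‖u n‖ ≤ C) (hu₁ : ∀ n, 1 ≤ n → ‖u₁ n‖ ≤ C)
    {P : Finset ℕ} (hP : ∀ p ∈ P, p.Prime) (hPu : ∀ p ∈ P, ∀ m, 1 ≤ m → u (p * m) = u₁ m)
    (w : ℕ → ℝ) (v : ℝ) :
    ‖(∑ p ∈ P, (w p : ℂ)) * limAvg U u v -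
      ∑ p ∈ P, (w p : ℂ) * limAvg U u₁ (v + Real.log p)‖ ^ 2 ≤ C ^ 2 * ∑ p ∈ P, p * w p ^ 2 := by
  refine le_of_forall_gt fun δ hδ => ?_
  obtain ⟨δ', h1, h2⟩ := exists_between hδ
  refine lt_of_le_of_lt ?_ h2
  have hlim : Tendsto (fun N : ℕ => ‖(∑ p ∈ P, (w p : ℂ)) * realAvg u (N * Real.exp (-v)) -
      ∑ p ∈ P, (w p : ℂ) * realAvg u₁ (N * Real.exp (-(v + Real.log p)))‖ ^ 2) U
      (𝓝 (‖(∑ p ∈ P, (w p : ℂ)) * limAvg U u v -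
        ∑ p ∈ P, (w p : ℂ) * limAvg U u₁ (v + Real.log p)‖ ^ 2)) :=
    ((((tendsto_limAvg hU hu v).const_mul _).sub
      (tendsto_finsetSum _ fun p _ => (tendsto_limAvg hU hu₁ _).const_mul _)).norm).pow 2
  refine le_of_tendsto hlim ?_
  filter_upwards [(tendsto_mul_exp hU v).eventually (eventually_turan_kubilius hu hP w h1)] with N hN
  refine le_trans (le_of_eq ?_) hN.le
  congr 3
  refine Finset.sum_congr rfl fun p hp => ?_
  have hp0 : (0 : ℝ) < p := by exact_mod_cast (hP p hp).pos
  rw [realAvg_congr (hPu p hp), neg_add, Real.exp_add, Real.exp_neg (Real.log p), Real.exp_log hp0, div_eq_mul_inv,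
    mul_assoc]

/-- The Turán–Kubilius inequality for infinite families of weights. -/
lemma limAvg_turan_kubilius_tsum (hu : ∀ n, 1 ≤ n → ‖u n‖ ≤ C) (hu₁ : ∀ n, 1 ≤ n → ‖u₁ n‖ ≤ C)
    {w : ℕ → ℝ} (hw : Summable w) (hw0 : ∀ n, 0 ≤ w n) (hwp : ∀ p, w p ≠ 0 → p.Prime)
    (hwu : ∀ p, w p ≠ 0 → ∀ m, 1 ≤ m → u (p * m) = u₁ m) {K : ℝ} (hK : ∀ n, n * w n ≤ K) (v : ℝ) :
    ‖((∑' n, w n : ℝ) : ℂ) * limAvg U u v -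
      ∑' n : ℕ, (w n : ℂ) * limAvg U u₁ (v + Real.log n)‖ ^ 2 ≤ C ^ 2 * (K * ∑' n, w n) := by
  have hs := (summable_mul_of_bounded hw hw0
    (g := fun n : ℕ => limAvg U u₁ (v + Real.log n)) fun n => norm_limAvg_le hU hu₁ _).hasSum
  have hs0 : HasSum (fun n => (w n : ℂ)) ((∑' n, w n : ℝ) : ℂ) := by
    exact_mod_cast hw.hasSum
  have hK0 : 0 ≤ K := by simpa using hK 0
  refine le_of_tendsto (((Tendsto.sub (Tendsto.mul_const _ hs0) hs).norm).pow 2)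
    (Eventually.of_forall fun s => ?_)
  have h := limAvg_turan_kubilius hU hu hu₁ (P := s.filter fun n => w n ≠ 0)
    (fun p hp => hwp p (Finset.mem_filter.1 hp).2) (fun p hp => hwu p (Finset.mem_filter.1 hp).2) w v
  have hr : ∀ {M : Type} [AddCommMonoid M] (g : ℕ → M), (∀ n, w n = 0 → g n = 0) →
      ∑ n ∈ s with w n ≠ 0, g n = ∑ n ∈ s, g n := fun g hg =>
    Finset.sum_filter_of_ne fun n _ hn h0 => hn (hg n h0)
  rw [hr _ (by simp +contextual), hr _ (by simp +contextual), hr _ (by simp +contextual)] at h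
  refine h.trans ?_
  gcongr
  calc ∑ p ∈ s, p * w p ^ 2 ≤ ∑ p ∈ s, K * w p := by
        refine Finset.sum_le_sum fun p _ => ?_
        rw [pow_two, ← mul_assoc]
        exact mul_le_mul_of_nonneg_right (hK p) (hw0 p)
    _ = K * ∑ p ∈ s, w p := by rw [Finset.mul_sum]
    _ ≤ K * ∑' n, w n := by
        gcongr
        exact hw.sum_le_tsum _ fun n _ => hw0 n

end LimAvg

/-! ### Almost invariant weights on the primes `p ≡ 1 mod q` -/

section Weights

open ArithmeticFunction vonMangoldt

variable (q : ℕ)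

lemma primeWeight_ne_zero {q : ℕ} {σ : ℝ} {n : ℕ} (h : primeWeight q σ n ≠ 0) :
    n.Prime ∧ (n : ZMod q) = 1 := by
  unfold primeWeight mangoldtWeight at h
  split_ifs at h with hp
  · refine ⟨hp, ?_⟩
    by_contra h1
    apply h
    rw [residueClass, Set.indicator_of_notMem (by simpa using h1), zero_div]
  · exact absurd rfl h

/-- Shaped for telescoping: with `y = σ log n`, the right side compares the scale `σ` with the next
dyadic scale `σ/2`. -/
lemma mul_exp_neg_two_mul_le {y : ℝ} (hy : 0 ≤ y) :
    y * Real.exp (-(2 * y)) ≤ 2 * (Real.exp (-(y / 2)) - Real.exp (-y)) := by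
  have h1 : Real.exp (-(2 * y)) ≤ Real.exp (-y) := Real.exp_le_exp.2 (by linarith)
  have h2 := Real.add_one_le_exp (y / 2)
  have h3 : Real.exp (-(y / 2)) = Real.exp (-y) * Real.exp (y / 2) := by
    rw [← Real.exp_add]; ring_nf
  have h4 := Real.exp_pos (-y)
  rw [h3]
  nlinarith

lemma natCast_mul_primeWeight_le {σ : ℝ} (hσ : 0 < σ) (n : ℕ) :
    n * (σ * primeWeight q σ n) ≤
      2 * (Real.exp (-(σ * Real.log n / 2)) - Real.exp (-(σ * Real.log n))) := by
  have hlog : 0 ≤ σ * Real.log n := mul_nonneg hσ.le (Real.log_natCast_nonneg n)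
  refine le_trans ?_ (mul_exp_neg_two_mul_le hlog)
  unfold primeWeight
  split_ifs with hp
  · have hn : (0 : ℝ) < n := by exact_mod_cast hp.pos
    have hr : residueClass (1 : ZMod q) n ≤ Real.log n :=
      (residueClass_le _ n).trans_eq (vonMangoldt_apply_prime hp)
    rw [mangoldtWeight, Real.rpow_add hn, Real.rpow_one, Real.rpow_def_of_pos hn (2 * σ)]
    have e : Real.exp (-(2 * (σ * Real.log n))) = (Real.exp (Real.log n * (2 * σ)))⁻¹ := by
      rw [← Real.exp_neg]; ring_nf
    rw [e]
    calc _ = σ * residueClass (1 : ZMod q) n * (Real.exp (Real.log n * (2 * σ)))⁻¹ := by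
          field_simp
      _ ≤ _ := by gcongr
  · rw [mul_zero, mul_zero]
    positivity

/-- Superposition of prime weights over `K` dyadic scales. -/
noncomputable def scaleWeight (k₀ K n : ℕ) : ℝ :=
  ∑ k ∈ Finset.range K, (1 / 2 : ℝ) ^ (k₀ + k) * primeWeight q ((1 / 2) ^ (k₀ + k)) n

lemma scaleWeight_nonneg (k₀ K n : ℕ) : 0 ≤ scaleWeight q k₀ K n :=
  Finset.sum_nonneg fun k _ => mul_nonneg (by positivity) (primeWeight_nonneg q _ n)

lemma scaleWeight_ne_zero {q k₀ K n : ℕ} (h : scaleWeight q k₀ K n ≠ 0) :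
    n.Prime ∧ (n : ZMod q) = 1 := by
  obtain ⟨k, -, hk⟩ := Finset.exists_ne_zero_of_sum_ne_zero h
  exact primeWeight_ne_zero (right_ne_zero_of_mul hk)

lemma summable_scaleWeight (k₀ K : ℕ) : Summable (scaleWeight q k₀ K) :=
  summable_sum fun k _ => (summable_primeWeight q (by positivity)).mul_left _

/-- The bounds at successive scales telescope, so the total is independent of the number `K` of
scales. -/
lemma natCast_mul_scaleWeight_le (k₀ K n : ℕ) : n * scaleWeight q k₀ K n ≤ 2 := by
  set y : ℕ → ℝ := fun k => Real.exp (-((1 / 2) ^ (k₀ + k) * Real.log n)) with hy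
  have h : n * scaleWeight q k₀ K n ≤ ∑ k ∈ Finset.range K, 2 * (y (k + 1) - y k) := by
    rw [scaleWeight, Finset.mul_sum]
    refine Finset.sum_le_sum fun k _ => ?_
    refine (natCast_mul_primeWeight_le q (by positivity) n).trans_eq ?_
    simp only [hy]
    rw [← add_assoc, pow_succ]
    ring_nf
  rw [← Finset.mul_sum, Finset.sum_range_sub] at h
  have h1 : y K ≤ 1 := Real.exp_le_one_iff.2
    (neg_nonpos.2 (mul_nonneg (by positivity) (Real.log_natCast_nonneg n)))
  have h2 : 0 < y 0 := Real.exp_pos _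
  linarith

lemma tsum_scaleWeight_mul (k₀ K : ℕ) {f : ℝ → ℂ} {C : ℝ} (hC : ∀ x, ‖f x‖ ≤ C) :
    ∑' n : ℕ, (scaleWeight q k₀ K n : ℂ) * f (Real.log n) =
      ∑ k ∈ Finset.range K, primeAbel q f ((1 / 2) ^ (k₀ + k)) := by
  have h : ∀ n : ℕ, (scaleWeight q k₀ K n : ℂ) * f (Real.log n) =
      ∑ k ∈ Finset.range K, ((((1 / 2 : ℝ) ^ (k₀ + k) : ℝ) : ℂ) *
        ((primeWeight q ((1 / 2) ^ (k₀ + k)) n : ℂ) * f (Real.log n))) := fun n => by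
    rw [scaleWeight]
    push_cast
    rw [Finset.sum_mul]
    refine Finset.sum_congr rfl fun k _ => by ring
  simp_rw [h]
  rw [Summable.tsum_finsetSum]
  · refine Finset.sum_congr rfl fun k _ => ?_
    rw [tsum_mul_left, primeAbel]
  · intro k _
    exact (summable_mul_of_bounded (summable_primeWeight q (by positivity))
      (primeWeight_nonneg q _) fun n => hC _).mul_left _

/-- There are weights on the primes `p ≡ 1 mod q`, suitable for the Turán–Kubilius inequality,
whose averages are nearly invariant under a given translation. -/
lemma exists_invariant_weights [NeZero q] {f : ℝ → ℂ} {C L : ℝ} (hC : ∀ x, ‖f x‖ ≤ C)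
    (hL : ∀ x y, ‖f x - f y‖ ≤ L * |x - y|) (b : ℝ) {ε : ℝ} (hε : 0 < ε) :
    ∃ w : ℕ → ℝ, Summable w ∧ (∀ n, 0 ≤ w n) ∧ (∀ p, w p ≠ 0 → p.Prime ∧ (p : ZMod q) = 1) ∧
      (∀ n : ℕ, n * w n ≤ 2) ∧ 1 / ε ≤ ∑' n, w n ∧
      ‖∑' n : ℕ, (w n : ℂ) * f (Real.log n + b) - ∑' n : ℕ, (w n : ℂ) * f (Real.log n)‖ ≤
        ε * ∑' n, w n := by
  set κ : ℝ := (q.totient : ℝ)⁻¹ with hκ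
  have hκ0 : 0 < κ := inv_pos.2 (by exact_mod_cast Nat.totient_pos.2 (NeZero.pos q))
  have hpow : Tendsto (fun k : ℕ => (1 / 2 : ℝ) ^ k) atTop (𝓝[>] 0) :=
    tendsto_nhdsWithin_iff.2 ⟨tendsto_pow_atTop_nhds_zero_of_lt_one (by norm_num) (by norm_num),
      Eventually.of_forall fun k => by simp⟩
  have h1 := (tendsto_primeAbel_translate q hC hL b).comp hpow
  have h2 := (Complex.continuous_re.tendsto _).comp ((tendsto_primeAbel_one q).comp hpow)
  have hre : ((q.totient : ℂ)⁻¹ / 2).re = κ / 2 := by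
    have : ((q.totient : ℂ)⁻¹ / 2) = ((κ / 2 : ℝ) : ℂ) := by rw [hκ]; push_cast; ring
    rw [this, Complex.ofReal_re]
  rw [hre] at h2
  -- Each scale has mass tending to `κ/2`, so eventually at least `κ/4`; the translation error is
  -- taken small relative to that.
  have h1' := h1.norm.eventually_le_const (u := ε * (κ / 4)) (by rw [norm_zero]; positivity)
  have h2' := h2.eventually_const_le (u := κ / 4) (by linarith)
  obtain ⟨k₀, hk₀⟩ := eventually_atTop.1 (h1'.and h2')
  -- Enough scales to bring the total mass above `1/ε`.
  obtain ⟨K, hK⟩ := exists_nat_ge (1 / ε / (κ / 4))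
  have hmass : K * (κ / 4) ≤ ∑' n, scaleWeight q k₀ K n := by
    have e1 := tsum_scaleWeight_mul q k₀ K (f := fun _ => 1) (C := 1) (by simp)
    have e2 : ∑' n, scaleWeight q k₀ K n =
        ∑ k ∈ Finset.range K, (primeAbel q (fun _ => 1) ((1 / 2) ^ (k₀ + k))).re := by
      rw [← Complex.re_sum, ← e1]
      simp only [mul_one]
      rw [← Complex.ofReal_tsum, Complex.ofReal_re]
    rw [e2]
    calc (K : ℝ) * (κ / 4) = ∑ k ∈ Finset.range K, κ / 4 := by simp
      _ ≤ _ := Finset.sum_le_sum fun k _ => (hk₀ (k₀ + k) (Nat.le_add_right _ _)).2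
  refine ⟨scaleWeight q k₀ K, summable_scaleWeight q k₀ K, scaleWeight_nonneg q k₀ K,
    fun p hp => scaleWeight_ne_zero hp, natCast_mul_scaleWeight_le q k₀ K, ?_, ?_⟩
  · exact ((div_le_iff₀ (by positivity)).1 hK).trans hmass
  · rw [tsum_scaleWeight_mul q k₀ K hC,
      tsum_scaleWeight_mul q k₀ K (f := fun x => f (x + b)) (fun x => hC _),
      ← Finset.sum_sub_distrib]
    refine (norm_sum_le_of_le _ fun k _ => (hk₀ (k₀ + k) (Nat.le_add_right _ _)).1).trans ?_
    rw [Finset.sum_const, Finset.card_range, nsmul_eq_mul]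
    nlinarith

end Weights

/-! ### Independence of scale and comparison of `u` with `u₁` -/

section Shift

variable {U : Ultrafilter ℕ} (hU : (U : Filter ℕ) ≤ atTop) {u u₁ u₂ : ℕ → ℂ} {C : ℝ}
  (q : ℕ) [NeZero q]
include hU

/-- The limit averages do not depend on the logarithmic scale. -/
lemma limAvg_eq_limAvg_zero (hu : ∀ n, 1 ≤ n → ‖u n‖ ≤ C) (hu₁ : ∀ n, 1 ≤ n → ‖u₁ n‖ ≤ C)
    (h : ∀ p : ℕ, p.Prime → (p : ZMod q) = 1 → ∀ m, 1 ≤ m → u (p * m) = u₁ m) (v : ℝ) :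
    limAvg U u v = limAvg U u 0 := by
  rw [← sub_eq_zero, ← norm_le_zero_iff]
  have hlim : Tendsto (fun ε : ℝ => 2 * √(2 * C ^ 2 * ε) + ε) (𝓝[>] 0) (𝓝 0) := by
    have : Continuous (fun ε : ℝ => 2 * √(2 * C ^ 2 * ε) + ε) := by fun_prop
    have h := this.tendsto 0
    simp only [mul_zero, Real.sqrt_zero, add_zero] at h
    exact h.mono_left nhdsWithin_le_nhds
  refine ge_of_tendsto hlim ?_
  filter_upwards [self_mem_nhdsWithin] with ε hε
  have hε : 0 < ε := hε
  obtain ⟨w, hw, hw0, hwp, hw2, hwW, hwt⟩ := exists_invariant_weights q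
    (norm_limAvg_le hU hu₁) (norm_limAvg_sub_le hU hu₁) v hε
  set W := ∑' n, w n with hW
  have hW0 : 0 < W := (by positivity : 0 < 1 / ε).trans_le hwW
  -- The squared error `2C²W` is at most `2C²εW²`, because `Wε ≥ 1`.
  have key : ∀ v : ℝ, ‖(W : ℂ) * limAvg U u v -
      ∑' n : ℕ, (w n : ℂ) * limAvg U u₁ (v + Real.log n)‖ ≤ W * √(2 * C ^ 2 * ε) := fun v => by
    have := limAvg_turan_kubilius_tsum hU hu hu₁ hw hw0 (fun p hp => (hwp p hp).1)
      (fun p hp => h p (hwp p hp).1 (hwp p hp).2) hw2 v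
    refine abs_le_of_sq_le_sq' ?_ (by positivity) |>.2
    refine this.trans ?_
    rw [mul_pow, Real.sq_sqrt (by positivity)]
    have : 1 ≤ W * ε := by rwa [div_le_iff₀ hε] at hwW
    have h3 : 0 ≤ C ^ 2 * W := by positivity
    nlinarith
  have k1 := key v
  have k0 := key 0
  simp only [zero_add] at k0
  simp only [add_comm v] at k1
  set S1 := ∑' n : ℕ, (w n : ℂ) * limAvg U u₁ (Real.log n + v)
  set S0 := ∑' n : ℕ, (w n : ℂ) * limAvg U u₁ (Real.log n)
  have e : (W : ℂ) * (limAvg U u v - limAvg U u 0) =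
      (W * limAvg U u v - S1) - (W * limAvg U u 0 - S0) + (S1 - S0) := by ring
  have h5 : W * ‖limAvg U u v - limAvg U u 0‖ ≤ W * (2 * √(2 * C ^ 2 * ε) + ε) := by
    calc W * ‖limAvg U u v - limAvg U u 0‖ = ‖(W : ℂ) * (limAvg U u v - limAvg U u 0)‖ := by
          rw [norm_mul, Complex.norm_real, Real.norm_of_nonneg hW0.le]
      _ ≤ W * √(2 * C ^ 2 * ε) + W * √(2 * C ^ 2 * ε) + ε * W := by
          rw [e]
          exact (norm_add_le _ _).trans (add_le_add ((norm_sub_le _ _).trans (add_le_add k1 k0)) hwt)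
      _ = _ := by ring
  exact le_of_mul_le_mul_left h5 hW0

/-- When the limit averages of `u₁` do not depend on scale, the sum over primes collapses to `W`
times their common value. Only the mass of the weights matters, hence the trivial translation 0. -/
lemma limAvg_zero_eq (hu : ∀ n, 1 ≤ n → ‖u n‖ ≤ C) (hu₁ : ∀ n, 1 ≤ n → ‖u₁ n‖ ≤ C)
    (h : ∀ p : ℕ, p.Prime → (p : ZMod q) = 1 → ∀ m, 1 ≤ m → u (p * m) = u₁ m)
    (hconst : ∀ v, limAvg U u₁ v = limAvg U u₁ 0) : limAvg U u 0 = limAvg U u₁ 0 := by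
  rw [← sub_eq_zero, ← norm_le_zero_iff]
  have hlim : Tendsto (fun ε : ℝ => √(2 * C ^ 2 * ε)) (𝓝[>] 0) (𝓝 0) := by
    have : Continuous (fun ε : ℝ => √(2 * C ^ 2 * ε)) := by fun_prop
    have h := this.tendsto 0
    simp only [mul_zero, Real.sqrt_zero] at h
    exact h.mono_left nhdsWithin_le_nhds
  refine ge_of_tendsto hlim ?_
  filter_upwards [self_mem_nhdsWithin] with ε hε
  have hε : 0 < ε := hε
  obtain ⟨w, hw, hw0, hwp, hw2, hwW, -⟩ := exists_invariant_weights q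
    (norm_limAvg_le hU hu₁) (norm_limAvg_sub_le hU hu₁) 0 hε
  set W := ∑' n, w n with hW
  have hW0 : 0 < W := (by positivity : 0 < 1 / ε).trans_le hwW
  have key := limAvg_turan_kubilius_tsum hU hu hu₁ hw hw0 (fun p hp => (hwp p hp).1)
      (fun p hp => h p (hwp p hp).1 (hwp p hp).2) hw2 0
  simp_rw [hconst] at key
  rw [tsum_mul_right, ← Complex.ofReal_tsum, ← hW, ← mul_sub, norm_mul, Complex.norm_real,
    Real.norm_of_nonneg hW0.le] at key
  refine Real.le_sqrt_of_sq_le ?_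
  have h1 : 1 ≤ W * ε := by rwa [div_le_iff₀ hε] at hwW
  have h3 : 0 ≤ C ^ 2 * W := by positivity
  refine le_of_mul_le_mul_left (a := W ^ 2) ?_ (by positivity)
  nlinarith

end Shift

/-- Averages of `u` and of `u₁` agree asymptotically if `u(pm) = u₁(m)` and `u₁(pm) = u₂(m)` for
all primes `p ≡ 1 mod q`. -/
theorem tendsto_cesaroAvg_sub_shift (q : ℕ) [NeZero q] {u u₁ u₂ : ℕ → ℂ} {C : ℝ}
    (hu : ∀ n, 1 ≤ n → ‖u n‖ ≤ C) (hu₁ : ∀ n, 1 ≤ n → ‖u₁ n‖ ≤ C) (hu₂ : ∀ n, 1 ≤ n → ‖u₂ n‖ ≤ C)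
    (h : ∀ p : ℕ, p.Prime → (p : ZMod q) = 1 → ∀ m, 1 ≤ m → u (p * m) = u₁ m)
    (h₁ : ∀ p : ℕ, p.Prime → (p : ZMod q) = 1 → ∀ m, 1 ≤ m → u₁ (p * m) = u₂ m) :
    Tendsto (fun N => cesaroAvg u N - cesaroAvg u₁ N) atTop (𝓝 0) := by
  rw [tendsto_iff_ultrafilter]
  intro U hU
  have h1 := (tendsto_limAvg hU hu 0).sub (tendsto_limAvg hU hu₁ 0)
  rw [limAvg_zero_eq hU q hu hu₁ h (limAvg_eq_limAvg_zero hU q hu₁ hu₂ h₁), sub_self] at h1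
  refine h1.congr fun N => ?_
  rw [neg_zero, Real.exp_zero, mul_one, cesaroAvg_eq_realAvg, cesaroAvg_eq_realAvg]

/-! ### Uniform convergence of ergodic averages -/

section UniquelyErgodic

variable {X : Type*} [MeasurableSpace X]

/-- The empirical measure of the orbit segment `x, T x, …, T^n x`. -/
noncomputable def empiricalMeasure (T : X → X) (x : X) (n : ℕ) : Measure X :=
  ((n + 1 : ℕ) : ENNReal)⁻¹ • ∑ h ∈ Finset.range (n + 1), Measure.dirac (T^[h] x)

lemma isProbabilityMeasure_empiricalMeasure (T : X → X) (x : X) (n : ℕ) :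
    IsProbabilityMeasure (empiricalMeasure T x n) := by
  refine ⟨?_⟩
  rw [empiricalMeasure, Measure.smul_apply, Measure.finsetSum_apply]
  simp only [measure_univ, Finset.sum_const, Finset.card_range, nsmul_eq_mul, mul_one, smul_eq_mul]
  exact ENNReal.inv_mul_cancel (by simp) (ENNReal.natCast_ne_top _)

lemma integral_empiricalMeasure [MeasurableSingletonClass X] {E : Type*} [NormedAddCommGroup E] [NormedSpace ℝ E]
    [CompleteSpace E] (T : X → X) (x : X) (n : ℕ) (g : X → E) :
    ∫ y, g y ∂empiricalMeasure T x n =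
      ((n + 1 : ℕ) : ℝ)⁻¹ • ∑ h ∈ Finset.range (n + 1), g (T^[h] x) := by
  rw [empiricalMeasure, integral_smul_measure, integral_finsetSum_measure]
  · rw [ENNReal.toReal_inv, ENNReal.toReal_natCast]
    simp only [integral_dirac]
  · intro h _
    exact integrable_dirac (by simp)

variable [MetricSpace X] [CompactSpace X] [BorelSpace X]

/-- Ergodic averages of a continuous function over a uniquely ergodic system converge
uniformly. -/
theorem IsUniquelyErgodic.exists_uniform_average {T : X → X} {μ : Measure X}
    (hμ : IsUniquelyErgodic T μ) (hT : Continuous T) (f : C(X, ℂ)) {ε : ℝ} (hε : 0 < ε) :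
    ∃ n : ℕ, ∀ x, ‖((n + 1 : ℕ) : ℝ)⁻¹ • ∑ h ∈ Finset.range (n + 1), f (T^[h] x) -
      ∫ y, f y ∂μ‖ ≤ ε := by
  by_contra! hcon
  choose x hx using hcon
  -- Empirical measures along orbit segments violating the bound. A limit point is invariant by
  -- telescoping, hence equals `μ`, against the violation.
  let m : ℕ → ProbabilityMeasure X := fun n =>
    ⟨empiricalMeasure T (x n) n, isProbabilityMeasure_empiricalMeasure T (x n) n⟩
  let U : Ultrafilter ℕ := Ultrafilter.of atTop
  have hU : (U : Filter ℕ) ≤ atTop := Ultrafilter.of_le _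
  obtain ⟨ν, -, hν⟩ := isCompact_univ.ultrafilter_le_nhds (U.map m) (by simp)
  have hν : Tendsto m U (𝓝 ν) := hν
  have hinv : Measure.map T (ν : Measure X) = ν := by
    have : IsProbabilityMeasure (Measure.map T (ν : Measure X)) :=
      Measure.isProbabilityMeasure_map hT.aemeasurable
    refine ext_of_forall_integral_eq_of_IsFiniteMeasure fun g => ?_
    rw [integral_map hT.aemeasurable g.continuous.aestronglyMeasurable]
    have h1 := ProbabilityMeasure.tendsto_iff_forall_integral_tendsto.1 hν g
    have h2 := ProbabilityMeasure.tendsto_iff_forall_integral_tendsto.1 hν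
      (g.compContinuous ⟨T, hT⟩)
    have h3 : Tendsto (fun n => (∫ y, g (T y) ∂(m n : Measure X)) - ∫ y, g y ∂(m n : Measure X))
        U (𝓝 0) := by
      have h4 : Tendsto (fun n : ℕ => ((n + 1 : ℕ) : ℝ)⁻¹ * (‖g‖ + ‖g‖)) U (𝓝 0) := by
        have : Tendsto (fun n : ℕ => ((n + 1 : ℕ) : ℝ)⁻¹ * (‖g‖ + ‖g‖)) atTop
            (𝓝 (0 * (‖g‖ + ‖g‖))) :=
          ((tendsto_inv_atTop_zero.comp tendsto_natCast_atTop_atTop).comp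
            (tendsto_add_atTop_nat 1)).mul_const _
        rw [zero_mul] at this
        exact this.mono_left hU
      refine squeeze_zero_norm (fun n => ?_) h4
      change ‖(∫ y, g (T y) ∂empiricalMeasure T (x n) n) -
        ∫ y, g y ∂empiricalMeasure T (x n) n‖ ≤ _
      rw [integral_empiricalMeasure, integral_empiricalMeasure, ← smul_sub,
        ← Finset.sum_sub_distrib]
      simp_rw [← Function.iterate_succ_apply' T]
      rw [Finset.sum_range_sub (fun h => g (T^[h] (x n))), norm_smul, norm_inv, Real.norm_natCast]
      gcongr
      exact (norm_sub_le _ _).trans (add_le_add (g.norm_coe_le_norm _) (g.norm_coe_le_norm _))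
    exact sub_eq_zero.1 (tendsto_nhds_unique (h2.sub h1) h3)
  have hνμ : (ν : Measure X) = μ := hμ.eq_of_invariant ν inferInstance ⟨hT.measurable, hinv⟩
  have h5 := ((ProbabilityMeasure.tendsto_iff_forall_integral_rclike_tendsto ℂ).1 hν
    (BoundedContinuousFunction.mkOfCompact f)).sub_const (∫ y, f y ∂μ)
  simp only [BoundedContinuousFunction.mkOfCompact_apply, hνμ, sub_self] at h5
  obtain ⟨n, hn⟩ := (h5.norm.eventually_lt_const (by simpa using hε)).exists
  have h6 := hx n
  rw [← integral_empiricalMeasure] at h6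
  exact lt_asymm hn h6

end UniquelyErgodic

/-! ### Ergodic averages along `Ω(n)` with weights -/

lemma norm_mul_apply_le {Y : Type*} [TopologicalSpace Y] [CompactSpace Y] {z : ℂ} {C : ℝ}
    (hz : ‖z‖ ≤ C) (f : C(Y, ℂ)) (y : Y) : ‖z * f y‖ ≤ C * ‖f‖ := by
  rw [norm_mul]
  exact mul_le_mul hz (f.norm_coe_le_norm _) (norm_nonneg _) ((norm_nonneg _).trans hz)

section ErgodicMean

variable {X : Type*} [MetricSpace X] [CompactSpace X] [MeasurableSpace X] [BorelSpace X]

/-- `a` has mean value `M`, and averages of `f(T^{Ω(n)}x)` weighted by `a` converge to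
`M ∫ f dμ`. -/
def HasErgodicMean (T : X → X) (μ : Measure X) (a : ℕ → ℂ) (M : ℂ) : Prop :=
  Tendsto (cesaroAvg a) atTop (𝓝 M) ∧ ∀ (f : C(X, ℂ)) (x : X),
    Tendsto (cesaroAvg fun n => a n * f (T^[ArithmeticFunction.cardFactors n] x)) atTop
      (𝓝 (M * ∫ y, f y ∂μ))

lemma cardFactors_prime_mul {p m : ℕ} (hp : p.Prime) (hm : 1 ≤ m) :
    ArithmeticFunction.cardFactors (p * m) = ArithmeticFunction.cardFactors m + 1 := by
  rw [ArithmeticFunction.cardFactors_mul hp.ne_zero (by omega),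
    ArithmeticFunction.cardFactors_apply_prime hp, add_comm]

variable {T : X → X} {μ : Measure X}

/-- All shifts `u j` have asymptotically the same averages, so `f` may be replaced by a long ergodic
average, uniformly close to its integral. -/
lemma IsUniquelyErgodic.hasErgodicMean_of_prime_invariant (hμ : IsUniquelyErgodic T μ)
    (hT : Continuous T) (q : ℕ) [NeZero q] {a : ℕ → ℂ} {C : ℝ} (ha : ∀ n, 1 ≤ n → ‖a n‖ ≤ C)
    (hinv : ∀ p : ℕ, p.Prime → (p : ZMod q) = 1 → ∀ m, a (p * m) = a m) {M : ℂ}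
    (hM : Tendsto (cesaroAvg a) atTop (𝓝 M)) : HasErgodicMean T μ a M := by
  refine ⟨hM, fun f x => ?_⟩
  have hC : 0 ≤ C := (norm_nonneg _).trans (ha 1 le_rfl)
  set u : ℕ → ℕ → ℂ := fun j n => a n * f (T^[ArithmeticFunction.cardFactors n + j] x) with hu
  have hub : ∀ j n, 1 ≤ n → ‖u j n‖ ≤ C * ‖f‖ := fun j n hn => norm_mul_apply_le (ha n hn) f _
  have hup : ∀ j (p : ℕ), p.Prime → (p : ZMod q) = 1 → ∀ m, 1 ≤ m → u j (p * m) = u (j + 1) m := by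
    intro j p hp hpq m hm
    simp only [hu]
    rw [cardFactors_prime_mul hp hm, hinv p hp hpq, add_right_comm, add_assoc]
  have hstep : ∀ j, Tendsto (fun N => cesaroAvg (u j) N - cesaroAvg (u (j + 1)) N) atTop (𝓝 0) :=
    fun j => tendsto_cesaroAvg_sub_shift q (hub j) (hub (j + 1)) (hub (j + 2)) (hup j)
      (hup (j + 1))
  have hall : ∀ j, Tendsto (fun N => cesaroAvg (u 0) N - cesaroAvg (u j) N) atTop (𝓝 0) := by
    intro j
    induction j with
    | zero => simp
    | succ j ih =>
      have := ih.add (hstep j)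
      rw [add_zero] at this
      exact this.congr fun N => by ring
  suffices h : Tendsto (fun N => cesaroAvg (u 0) N - cesaroAvg a N * ∫ y, f y ∂μ) atTop (𝓝 0) by
    have h2 := h.add (hM.mul_const (∫ y, f y ∂μ))
    rw [zero_add] at h2
    exact h2.congr fun N => by simp [hu]
  rw [Metric.tendsto_nhds]
  intro ε hε
  obtain ⟨n, hn⟩ := hμ.exists_uniform_average hT f (ε := ε / (2 * (C + 1))) (by positivity)
  have hs : Tendsto (fun N => ((n + 1 : ℕ) : ℂ)⁻¹ * ∑ j ∈ Finset.range (n + 1),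
      (cesaroAvg (u 0) N - cesaroAvg (u j) N)) atTop (𝓝 0) := by
    have := (tendsto_finsetSum (Finset.range (n + 1)) fun j _ => hall j).const_mul
      (((n + 1 : ℕ) : ℂ)⁻¹)
    simpa using this
  have hn0 : ((n + 1 : ℕ) : ℂ) ≠ 0 := by exact_mod_cast Nat.succ_ne_zero n
  filter_upwards [hs.norm.eventually_lt_const (u := ε / 2) (by simpa using hε),
    eventually_gt_atTop 0] with N hN hN0
  have hN0 : (0 : ℝ) < N := by exact_mod_cast hN0
  set I := ∫ y, f y ∂μ with hI
  set v : ℕ → ℂ := fun k => a k * (((n + 1 : ℕ) : ℂ)⁻¹ * (∑ j ∈ Finset.range (n + 1),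
    f (T^[ArithmeticFunction.cardFactors k + j] x)) - I) with hv
  have hvb : ‖cesaroAvg v N‖ ≤ C * (ε / (2 * (C + 1))) := by
    rw [cesaroAvg_eq_realAvg]
    refine realAvg_norm_le (fun k hk => ?_) hN0
    rw [hv]
    simp only
    rw [norm_mul]
    refine mul_le_mul (ha k hk) ?_ (norm_nonneg _) hC
    have := hn (T^[ArithmeticFunction.cardFactors k] x)
    simp_rw [← Function.iterate_add_apply] at this
    convert! this using 3
    rw [Complex.real_smul]
    push_cast
    congr 1
    exact Finset.sum_congr rfl fun j _ => by rw [add_comm]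
  have e : cesaroAvg (u 0) N - cesaroAvg a N * I = ((n + 1 : ℕ) : ℂ)⁻¹ *
      ∑ j ∈ Finset.range (n + 1), (cesaroAvg (u 0) N - cesaroAvg (u j) N) + cesaroAvg v N := by
    have e1 : cesaroAvg v N = ((n + 1 : ℕ) : ℂ)⁻¹ * ∑ j ∈ Finset.range (n + 1), cesaroAvg (u j) N -
        I * cesaroAvg a N := by
      simp_rw [cesaroAvg_eq_realAvg]
      rw [← realAvg_sum, ← realAvg_const_mul, ← realAvg_const_mul, ← realAvg_sub]
      congr 1
      funext k
      simp only [hv, hu, mul_sub, Finset.mul_sum]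
      congr 1
      · exact Finset.sum_congr rfl fun j _ => by ring
      · ring
    rw [e1, Finset.sum_sub_distrib, Finset.sum_const, Finset.card_range, nsmul_eq_mul]
    field_simp
    ring
  rw [dist_zero_right, e]
  refine (norm_add_le _ _).trans_lt ?_
  have h3 : C * (ε / (2 * (C + 1))) ≤ ε / 2 := by
    rw [mul_div_assoc', div_le_div_iff₀ (by positivity) two_pos]
    nlinarith
  linarith

/-! ### Exponential weights -/

lemma addExp_natCast_mul (n : ℕ) (α : ℝ) : addExp (n * α) = addExp α ^ n := by
  rw [addExp, addExp, ← Complex.exp_nat_mul]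
  push_cast
  ring_nf

lemma addExp_intCast (n : ℤ) : addExp n = 1 := by
  rw [addExp, show (2 * Real.pi * Complex.I * ((n : ℝ) : ℂ) : ℂ) =
    n * (2 * Real.pi * Complex.I) by push_cast; ring]
  exact Complex.exp_int_mul_two_pi_mul_I n

lemma norm_sum_addExp_le {β : ℝ} (hβ : addExp β ≠ 1) (N : ℕ) :
    ‖∑ n ∈ Finset.Icc 1 N, addExp (n * β)‖ ≤ 2 / ‖addExp β - 1‖ := by
  have h1 : ∑ n ∈ Finset.Icc 1 N, addExp (n * β) =
      addExp β * ((addExp β ^ N - 1) / (addExp β - 1)) := by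
    rw [← geom_sum_eq hβ, Finset.mul_sum]
    change ∑ n ∈ Finset.Ico 1 (N + 1), _ = _
    rw [Finset.sum_Ico_eq_sum_range, Nat.add_sub_cancel]
    refine Finset.sum_congr rfl fun n _ => ?_
    rw [addExp_natCast_mul, pow_add, pow_one]
  rw [h1, norm_mul, norm_addExp, one_mul, norm_div]
  gcongr
  refine (norm_sub_le _ _).trans ?_
  rw [norm_pow, norm_addExp, one_pow, norm_one]
  norm_num

lemma tendsto_cesaroAvg_addExp (α : ℝ) :
    Tendsto (cesaroAvg fun n => addExp (n * α)) atTop (𝓝 (if addExp α = 1 then 1 else 0)) := by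
  split_ifs with h
  · have : (fun n : ℕ => addExp (n * α)) = fun _ => 1 := by
      funext n
      rw [addExp_natCast_mul, h, one_pow]
    rw [this]
    exact (tendsto_realAvg_one.comp tendsto_natCast_atTop_atTop).congr fun N =>
      (cesaroAvg_eq_realAvg _ N).symm
  · have h1 : Tendsto (fun N : ℕ => 2 / ‖addExp α - 1‖ / (N : ℝ)) atTop (𝓝 0) :=
      tendsto_natCast_atTop_atTop.const_div_atTop _
    refine squeeze_zero_norm (fun N => ?_) h1
    rw [cesaroAvg, norm_mul, norm_div, norm_one, Complex.norm_natCast, one_div, inv_mul_eq_div]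
    gcongr
    exact norm_sum_addExp_le h N

lemma IsUniquelyErgodic.hasErgodicMean_addExp_rat (hμ : IsUniquelyErgodic T μ)
    (hT : Continuous T) {α : ℝ} {q : ℕ} (hq : 0 < q) {r : ℤ} (hα : q * α = r) :
    HasErgodicMean T μ (fun n => addExp (n * α)) (if addExp α = 1 then 1 else 0) := by
  have : NeZero q := ⟨hq.ne'⟩
  refine hμ.hasErgodicMean_of_prime_invariant hT q (C := 1) (by simp) (fun p hp hpq m => ?_)
    (tendsto_cesaroAvg_addExp α)
  -- Writing `p = 1 + qk`, the numbers `pmα` and `mα` differ by the integer `kmr`.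
  have h1 : (q : ℤ) ∣ p - 1 := by
    rw [← ZMod.intCast_zmod_eq_zero_iff_dvd]
    simp [hpq]
  obtain ⟨k, hk⟩ := h1
  have h2 : (p : ℝ) = 1 + q * k := by
    have : (p : ℤ) = 1 + q * k := by linarith
    exact_mod_cast this
  have h3 : ((p * m : ℕ) : ℝ) * α = m * α + ((k * m * r : ℤ) : ℝ) := by
    push_cast
    rw [h2, ← hα]
    ring
  rw [h3, addExp_add, addExp_intCast, mul_one]

end ErgodicMean

/-! ### Irrational frequencies -/

lemma sum_Icc_ite_mul_le (N : ℕ) {p : ℕ} (hp : 0 < p) (w : ℕ → ℂ) :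
    ∑ m ∈ Finset.Icc 1 N, (if p * m ≤ N then w m else 0) = ∑ m ∈ Finset.Icc 1 (N / p), w m := by
  rw [← Finset.sum_filter]
  congr 1
  ext m
  simp only [Finset.mem_filter, Finset.mem_Icc, Nat.le_div_iff_mul_le hp, mul_comm m p]
  constructor
  · rintro ⟨⟨h1, -⟩, h2⟩
    exact ⟨h1, h2⟩
  · rintro ⟨h1, h2⟩
    exact ⟨⟨h1, (Nat.le_mul_of_pos_left m hp).trans h2⟩, h2⟩

/-- The exponential sum `∑_{p ∈ P, pm ≤ N} e(pmα)`. -/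
noncomputable def primeExpSum (P : Finset ℕ) (α : ℝ) (N m : ℕ) : ℂ :=
  ∑ p ∈ P, if p * m ≤ N then addExp ((p * m : ℕ) * α) else 0

lemma sum_inv_mul_realAvg_addExp {P : Finset ℕ} (hP : ∀ p ∈ P, p.Prime) (α : ℝ) (F : ℕ → ℂ)
    (t : ℝ) :
    ∑ p ∈ P, (p : ℂ)⁻¹ * realAvg (fun m => addExp ((p * m : ℕ) * α) * F m) (t / p) =
      realAvg (fun m => F m * primeExpSum P α ⌊t⌋₊ m) t := by
  simp_rw [primeExpSum, Finset.mul_sum]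
  rw [realAvg_sum]
  refine Finset.sum_congr rfl fun p hp => ?_
  have hp0 : (p : ℂ) ≠ 0 := by exact_mod_cast (hP p hp).ne_zero
  simp_rw [mul_ite, mul_zero, realAvg]
  rw [sum_Icc_ite_mul_le _ (hP p hp).pos, Nat.floor_div_natCast]
  push_cast
  rw [inv_div, ← mul_assoc, ← mul_div_assoc, inv_mul_cancel₀ hp0, one_div]
  congr 1
  exact Finset.sum_congr rfl fun m _ => mul_comm _ _

lemma addExp_neg (x : ℝ) : addExp (-x) = (starRingEnd ℂ) (addExp x) := by
  rw [addExp, addExp, ← Complex.exp_conj]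
  simp [map_ofNat (starRingEnd ℂ) 2]

/-- Expanding the square, the diagonal gives `∑ 1/p`; for `p ≠ r` the geometric sum in `e(m(p-r)α)`
is bounded independently of `t`. -/
lemma norm_realAvg_primeExpSum_sq_le {P : Finset ℕ} (hP : ∀ p ∈ P, p.Prime) {α : ℝ}
    (hα : ∀ k : ℤ, k ≠ 0 → addExp (k * α) ≠ 1) {t : ℝ} (ht : 0 < t) :
    ‖realAvg (fun m => ((‖primeExpSum P α ⌊t⌋₊ m‖ ^ 2 : ℝ) : ℂ)) t‖ ≤
      ∑ p ∈ P, (p : ℝ)⁻¹ +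
        (∑ p ∈ P, ∑ r ∈ P, 2 / ‖addExp (((p - r : ℤ) : ℝ) * α) - 1‖) / t := by
  set N := ⌊t⌋₊ with hN
  have hsq : ∀ m, ((‖primeExpSum P α N m‖ ^ 2 : ℝ) : ℂ) = ∑ p ∈ P, ∑ r ∈ P,
      (if p * m ≤ N then (if r * m ≤ N then addExp (m * (((p - r : ℤ) : ℝ) * α)) else 0) else 0) := by
    intro m
    rw [Complex.ofReal_pow, ← Complex.mul_conj', primeExpSum, map_sum, Finset.sum_mul_sum]
    refine Finset.sum_congr rfl fun p _ => Finset.sum_congr rfl fun r _ => ?_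
    split_ifs
    · rw [← addExp_neg, ← addExp_add]
      congr 1
      push_cast
      ring
    all_goals simp
  have hpair : ∀ p ∈ P, ∀ r ∈ P, ‖∑ m ∈ Finset.Icc 1 N,
      (if p * m ≤ N then (if r * m ≤ N then addExp (m * (((p - r : ℤ) : ℝ) * α)) else 0) else 0)‖ ≤
      (if p = r then t * (p : ℝ)⁻¹ else 0) + 2 / ‖addExp (((p - r : ℤ) : ℝ) * α) - 1‖ := by
    intro p hp r hr
    rw [sum_Icc_ite_mul_le _ (hP p hp).pos]
    have h1 : ∑ m ∈ Finset.Icc 1 (N / p), (if r * m ≤ N then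
        addExp (m * (((p - r : ℤ) : ℝ) * α)) else 0) =
        ∑ m ∈ Finset.Icc 1 (min (N / p) (N / r)), addExp (m * (((p - r : ℤ) : ℝ) * α)) := by
      rw [← Finset.sum_filter]
      congr 1
      ext m
      simp only [Finset.mem_filter, Finset.mem_Icc, le_min_iff, mul_comm r m,
        Nat.le_div_iff_mul_le (hP r hr).pos, and_assoc]
    rw [h1]
    split_ifs with h
    · subst h
      refine le_add_of_le_of_nonneg ?_ (by positivity)
      refine (norm_sum_le_of_le _ fun m _ => (norm_addExp _).le).trans ?_
      rw [Finset.sum_const, Nat.card_Icc, nsmul_eq_mul, mul_one, min_self, Nat.add_sub_cancel]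
      refine Nat.cast_div_le.trans ?_
      rw [div_eq_mul_inv]
      gcongr
      exact Nat.floor_le ht.le
    · rw [zero_add]
      refine norm_sum_addExp_le (hα _ ?_) _
      rw [sub_ne_zero]
      exact_mod_cast h
  rw [realAvg, norm_mul, norm_inv, Complex.norm_real, Real.norm_of_nonneg ht.le]
  simp_rw [hsq]
  rw [Finset.sum_comm]
  simp_rw [Finset.sum_comm (s := Finset.Icc 1 _) (t := P)]
  calc _ ≤ t⁻¹ * ∑ p ∈ P, ∑ r ∈ P, ((if p = r then t * (p : ℝ)⁻¹ else 0) +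
        2 / ‖addExp (((p - r : ℤ) : ℝ) * α) - 1‖) := by
        gcongr
        exact norm_sum_le_of_le _ fun p hp => norm_sum_le_of_le _ fun r hr => hpair p hp r hr
    _ = _ := by
        simp_rw [Finset.sum_add_distrib, Finset.sum_ite_eq]
        rw [Finset.sum_congr rfl fun p hp => if_pos hp, ← Finset.mul_sum, mul_add, ← mul_assoc,
          inv_mul_cancel₀ ht.ne', one_mul, inv_mul_eq_div]

/-- Orthogonality of irrational exponentials to functions `F` for which `F(pn)` does not depend
on the prime `p`. -/
theorem tendsto_cesaroAvg_addExp_mul_zero {α : ℝ} (hα : ∀ k : ℤ, k ≠ 0 → addExp (k * α) ≠ 1)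
    {F F₁ : ℕ → ℂ} {C : ℝ} (hF : ∀ n, 1 ≤ n → ‖F n‖ ≤ C) (hF₁ : ∀ n, 1 ≤ n → ‖F₁ n‖ ≤ C)
    (h : ∀ p : ℕ, p.Prime → ∀ m, 1 ≤ m → F (p * m) = F₁ m) :
    Tendsto (cesaroAvg fun n => addExp (n * α) * F n) atTop (𝓝 0) := by
  have hC : 0 ≤ C := (norm_nonneg _).trans (hF 1 le_rfl)
  set u : ℕ → ℂ := fun n => addExp (n * α) * F n with hu
  have hub : ∀ n, 1 ≤ n → ‖u n‖ ≤ C := fun n hn => by simpa [hu] using hF n hn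
  -- the bound coming from a finite set of primes
  have key : ∀ P : Finset ℕ, (∀ p ∈ P, p.Prime) → ∀ᶠ t in atTop,
      (∑ p ∈ P, (p : ℝ)⁻¹) * ‖realAvg u t‖ ≤ 2 * √(C ^ 2 * (∑ p ∈ P, (p : ℝ)⁻¹) + 1) := by
    intro P hP
    set W := ∑ p ∈ P, (p : ℝ)⁻¹ with hW
    have hW0 : 0 ≤ W := Finset.sum_nonneg fun p _ => by positivity
    set D := ∑ p ∈ P, ∑ r ∈ P, 2 / ‖addExp (((p - r : ℤ) : ℝ) * α) - 1‖ with hD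
    have hw : C ^ 2 * ∑ p ∈ P, (p : ℝ) * ((p : ℝ)⁻¹) ^ 2 < C ^ 2 * W + 1 := by
      have : ∑ p ∈ P, (p : ℝ) * ((p : ℝ)⁻¹) ^ 2 = W := Finset.sum_congr rfl fun p hp => by
        have : (p : ℝ) ≠ 0 := by exact_mod_cast (hP p hp).ne_zero
        field_simp
      rw [this]
      linarith
    have h1 := eventually_turan_kubilius hub hP (fun p => (p : ℝ)⁻¹) hw
    have h2 : Tendsto (fun t : ℝ => C ^ 2 * (W + D / t)) atTop (𝓝 (C ^ 2 * (W + 0))) :=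
      ((tendsto_id.const_div_atTop D).const_add W).const_mul _
    rw [add_zero] at h2
    filter_upwards [h1, h2.eventually_le_const (lt_add_one _), eventually_gt_atTop 0]
      with t ht1 ht2 ht0
    have e : ∑ p ∈ P, (((p : ℝ)⁻¹ : ℝ) : ℂ) * realAvg (fun m => u (p * m)) (t / p) =
        realAvg (fun m => F₁ m * primeExpSum P α ⌊t⌋₊ m) t := by
      rw [← sum_inv_mul_realAvg_addExp hP]
      refine Finset.sum_congr rfl fun p hp => ?_
      rw [Complex.ofReal_inv, Complex.ofReal_natCast]
      congr 1
      refine realAvg_congr (fun m hm => ?_) _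
      rw [hu]
      simp only
      rw [h p (hP p hp) m hm]
    have h3 : ‖realAvg (fun m => F₁ m * primeExpSum P α ⌊t⌋₊ m) t‖ ≤ √(C ^ 2 * W + 1) := by
      refine Real.le_sqrt_of_sq_le ((norm_sq_realAvg_mul_le hF₁ ht0).trans (le_trans ?_ ht2))
      gcongr
      exact norm_realAvg_primeExpSum_sq_le hP hα ht0
    have h4 := Real.le_sqrt_of_sq_le ht1.le
    rw [e, ← Complex.ofReal_sum, ← hW] at h4
    calc W * ‖realAvg u t‖ = ‖(W : ℂ) * realAvg u t‖ := by
          rw [norm_mul, Complex.norm_real, Real.norm_of_nonneg hW0]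
      _ ≤ √(C ^ 2 * W + 1) + √(C ^ 2 * W + 1) := by
          refine le_trans ?_ (add_le_add h4 h3)
          simpa using norm_add_le ((W : ℂ) * realAvg u t -
            realAvg (fun m => F₁ m * primeExpSum P α ⌊t⌋₊ m) t)
            (realAvg (fun m => F₁ m * primeExpSum P α ⌊t⌋₊ m) t)
      _ = _ := by ring
  have hlim : Tendsto (fun W : ℝ => 2 * √(C ^ 2 * W + 1) / W) atTop (𝓝 0) := by
    have h1 : Tendsto (fun W : ℝ => 2 * √(C ^ 2 * W⁻¹ + W⁻¹ ^ 2)) atTop (𝓝 0) := by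
      have : Continuous (fun x : ℝ => 2 * √(C ^ 2 * x + x ^ 2)) := by fun_prop
      have h := this.tendsto 0
      norm_num at h
      exact h.comp tendsto_inv_atTop_zero
    refine h1.congr' ?_
    filter_upwards [eventually_gt_atTop 0] with W hW
    have : C ^ 2 * W⁻¹ + W⁻¹ ^ 2 = (C ^ 2 * W + 1) / W ^ 2 := by field_simp
    rw [this, Real.sqrt_div' _ (by positivity), Real.sqrt_sq hW.le, mul_div_assoc]
  rw [Metric.tendsto_nhds]
  intro ε hε
  obtain ⟨W₀, hW₀⟩ := eventually_atTop.1 ((hlim.eventually_lt_const hε).and (eventually_gt_atTop 0))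
  -- Divergence of the sum of reciprocals of the primes.
  obtain ⟨P, hP, hPW⟩ : ∃ P : Finset ℕ, (∀ p ∈ P, p.Prime) ∧ W₀ ≤ ∑ p ∈ P, (p : ℝ)⁻¹ := by
    have h1 := Nat.Primes.not_summable_one_div
    have h2 := (not_summable_iff_tendsto_nat_atTop_of_nonneg (f := Set.indicator {p : ℕ | p.Prime}
      (fun n : ℕ => 1 / (n : ℝ))) (fun n => Set.indicator_nonneg (fun _ _ => by positivity) n)).1
      (by
        intro hs
        exact h1 ((summable_subtype_iff_indicator (f := fun n : ℕ => 1 / (n : ℝ))).2 hs))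
    obtain ⟨n, hn⟩ := (h2.eventually_ge_atTop W₀).exists
    refine ⟨(Finset.range n).filter Nat.Prime, fun p hp => (Finset.mem_filter.1 hp).2,
      hn.trans_eq ?_⟩
    rw [Finset.sum_filter]
    refine Finset.sum_congr rfl fun p _ => ?_
    simp [Set.indicator_apply]
  obtain ⟨hlt, hpos⟩ := hW₀ _ hPW
  filter_upwards [tendsto_natCast_atTop_atTop.eventually (key P hP)] with N hN
  rw [dist_zero_right, cesaroAvg_eq_realAvg]
  refine lt_of_le_of_lt ?_ hlt
  rw [le_div_iff₀ hpos, mul_comm]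
  exact hN

section ErgodicMean

variable {X : Type*} [MetricSpace X] [CompactSpace X] [MeasurableSpace X] [BorelSpace X]
  {T : X → X} {μ : Measure X}

theorem IsUniquelyErgodic.hasErgodicMean_addExp (hμ : IsUniquelyErgodic T μ)
    (hT : Continuous T) (α : ℝ) :
    HasErgodicMean T μ (fun n => addExp (n * α)) (if addExp α = 1 then 1 else 0) := by
  by_cases hα : ∀ k : ℤ, k ≠ 0 → addExp (k * α) ≠ 1
  · refine ⟨tendsto_cesaroAvg_addExp α, fun f x => ?_⟩
    rw [if_neg (by simpa using hα 1 one_ne_zero), zero_mul]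
    refine tendsto_cesaroAvg_addExp_mul_zero hα (C := ‖f‖)
      (F₁ := fun n => f (T^[ArithmeticFunction.cardFactors n + 1] x))
      (fun n _ => f.norm_coe_le_norm _) (fun n _ => f.norm_coe_le_norm _) fun p hp m hm => ?_
    rw [cardFactors_prime_mul hp hm]
  · push Not at hα
    obtain ⟨k, hk0, hk⟩ := hα
    rw [addExp, Complex.exp_eq_one_iff] at hk
    obtain ⟨r, hr⟩ := hk
    have hr' : (k : ℝ) * α = r := by
      have h1 : (2 * Real.pi * Complex.I : ℂ) ≠ 0 := Complex.two_pi_I_ne_zero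
      have h2 : (((k : ℝ) * α : ℝ) : ℂ) = ((r : ℝ) : ℂ) := by
        refine mul_left_cancel₀ h1 ?_
        rw [hr]
        push_cast
        ring
      exact_mod_cast h2
    have hq : 0 < k.natAbs := Int.natAbs_pos.2 hk0
    refine hμ.hasErgodicMean_addExp_rat hT hq (r := k.sign * r) ?_
    push_cast
    rw [← hr', ← mul_assoc]
    congr 1
    rcases lt_or_gt_of_ne hk0 with h | h
    · rw [Int.sign_eq_neg_one_of_neg h]
      have : |k| = -k := abs_of_neg h
      simp [Nat.cast_natAbs, this]
    · rw [Int.sign_eq_one_of_pos h]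
      have : |k| = k := abs_of_pos h
      simp [Nat.cast_natAbs, this]

end ErgodicMean

/-! ### Besicovitch almost periodic functions -/

lemma trigPoly_eq_sum_addExp {L : ℕ} (c : Fin L → ℂ) (α : Fin L → ℝ) (n : ℕ) :
    trigPoly c α n = ∑ j, c j * addExp (n * α j) := by
  simp only [trigPoly, addExp]
  push_cast
  rfl

lemma norm_trigPoly_le {L : ℕ} (c : Fin L → ℂ) (α : Fin L → ℝ) (n : ℕ) :
    ‖trigPoly c α n‖ ≤ ∑ j, ‖c j‖ := by
  rw [trigPoly_eq_sum_addExp]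
  exact norm_sum_le_of_le _ fun j _ => by simp

lemma cesaroAvg_trigPoly_mul {L : ℕ} (c : Fin L → ℂ) (α : Fin L → ℝ) (g : ℕ → ℂ) (N : ℕ) :
    cesaroAvg (fun n => trigPoly c α n * g n) N =
      ∑ j, c j * cesaroAvg (fun n => addExp (n * α j) * g n) N := by
  simp_rw [cesaroAvg_eq_realAvg, ← realAvg_const_mul, trigPoly_eq_sum_addExp, Finset.sum_mul,
    mul_assoc]
  rw [realAvg_sum]

/-- The mean value of a trigonometric polynomial. -/
noncomputable def trigMean {L : ℕ} (c : Fin L → ℂ) (α : Fin L → ℝ) : ℂ :=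
  ∑ j, c j * if addExp (α j) = 1 then 1 else 0

lemma tendsto_cesaroAvg_trigPoly {L : ℕ} (c : Fin L → ℂ) (α : Fin L → ℝ) :
    Tendsto (cesaroAvg (trigPoly c α)) atTop (𝓝 (trigMean c α)) := by
  refine (tendsto_finsetSum Finset.univ fun j _ =>
    (tendsto_cesaroAvg_addExp (α j)).const_mul (c j)).congr fun N => ?_
  have := cesaroAvg_trigPoly_mul c α (fun _ => 1) N
  simp only [mul_one] at this
  exact this.symm

lemma norm_cesaroAvg_mul_sub_le {a b g : ℕ → ℂ} {D : ℝ} (hg : ∀ n, ‖g n‖ ≤ D) (N : ℕ) :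
    ‖cesaroAvg (fun n => a n * g n) N - cesaroAvg (fun n => b n * g n) N‖ ≤
      (1 / (N : ℝ)) * (∑ n ∈ Finset.Icc 1 N, ‖a n - b n‖) * D := by
  rw [cesaroAvg, cesaroAvg, ← mul_sub, ← Finset.sum_sub_distrib, norm_mul, norm_div, norm_one,
    Complex.norm_natCast, mul_assoc, Finset.sum_mul]
  gcongr
  refine norm_sum_le_of_le _ fun n _ => ?_
  rw [← sub_mul, norm_mul]
  exact mul_le_mul_of_nonneg_left (hg n) (norm_nonneg _)

namespace IsBesicovitchAlmostPeriodic

variable {a : ℕ → ℂ} (ha : IsBesicovitchAlmostPeriodic a)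
include ha

lemma exists_trigPoly_approx {ε : ℝ} (hε : 0 < ε) :
    ∃ (L : ℕ) (c : Fin L → ℂ) (α : Fin L → ℝ), ∀ᶠ N : ℕ in atTop,
      (1 / (N : ℝ)) * ∑ n ∈ Finset.Icc 1 N, ‖a n - trigPoly c α n‖ < ε := by
  obtain ⟨C, hC⟩ := ha.bounded
  obtain ⟨L, c, α, h⟩ := ha.approx (ε / 2) (half_pos hε)
  refine ⟨L, c, α, eventually_lt_of_limsup_lt (h.trans_lt (half_lt_self hε)) ?_⟩
  refine isBoundedUnder_of ⟨C + ∑ j, ‖c j‖, fun N => ?_⟩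
  have hD : 0 ≤ C + ∑ j, ‖c j‖ :=
    add_nonneg ((norm_nonneg _).trans (hC 1 le_rfl)) (Finset.sum_nonneg fun j _ => norm_nonneg _)
  rw [one_div, inv_mul_eq_div]
  refine div_le_of_le_mul₀ N.cast_nonneg hD ?_
  calc ∑ n ∈ Finset.Icc 1 N, ‖a n - trigPoly c α n‖
      ≤ ∑ n ∈ Finset.Icc 1 N, (C + ∑ j, ‖c j‖) := Finset.sum_le_sum fun n hn =>
        (norm_sub_le _ _).trans (add_le_add (hC n (Finset.mem_Icc.1 hn).1) (norm_trigPoly_le c α n))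
    _ = (C + ∑ j, ‖c j‖) * N := by
        rw [Finset.sum_const, Nat.card_Icc, nsmul_eq_mul, Nat.add_sub_cancel, mul_comm]

lemma exists_mean : ∃ M, Tendsto (cesaroAvg a) atTop (𝓝 M) := by
  refine cauchySeq_tendsto_of_complete (Metric.cauchySeq_iff'.2 fun ε hε => ?_)
  obtain ⟨L, c, α, h⟩ := ha.exists_trigPoly_approx (ε := ε / 4) (by positivity)
  have h1 : ∀ᶠ N in atTop, dist (cesaroAvg (trigPoly c α) N) (trigMean c α) < ε / 4 :=
    Metric.tendsto_nhds.1 (tendsto_cesaroAvg_trigPoly c α) _ (by positivity)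
  obtain ⟨N₀, hN₀⟩ := eventually_atTop.1 (h.and h1)
  have h2 : ∀ N ≥ N₀, dist (cesaroAvg a N) (trigMean c α) < ε / 2 := fun N hN => by
    obtain ⟨h3, h4⟩ := hN₀ N hN
    have h5 := norm_cesaroAvg_mul_sub_le (a := a) (b := trigPoly c α) (g := fun _ => 1) (D := 1)
      (by simp) N
    simp only [mul_one] at h5
    rw [← dist_eq_norm] at h5
    linarith [dist_triangle (cesaroAvg a N) (cesaroAvg (trigPoly c α) N) (trigMean c α)]
  refine ⟨N₀, fun N hN => ?_⟩
  linarith [dist_triangle_right (cesaroAvg a N) (cesaroAvg a N₀) (trigMean c α), h2 N hN,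
    h2 N₀ le_rfl]

end IsBesicovitchAlmostPeriodic

section ErgodicMean

variable {X : Type*} [MetricSpace X] [CompactSpace X] [MeasurableSpace X] [BorelSpace X]
  {T : X → X} {μ : Measure X}

lemma IsUniquelyErgodic.hasErgodicMean_trigPoly (hμ : IsUniquelyErgodic T μ)
    (hT : Continuous T) {L : ℕ} (c : Fin L → ℂ) (α : Fin L → ℝ) :
    HasErgodicMean T μ (trigPoly c α) (trigMean c α) := by
  refine ⟨tendsto_cesaroAvg_trigPoly c α, fun f x => ?_⟩
  rw [trigMean, Finset.sum_mul]
  simp_rw [mul_assoc]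
  exact (tendsto_finsetSum Finset.univ fun j _ =>
    ((hμ.hasErgodicMean_addExp hT (α j)).2 f x).const_mul (c j)).congr fun N =>
      (cesaroAvg_trigPoly_mul c α _ N).symm

theorem IsUniquelyErgodic.hasErgodicMean_of_besicovitch (hμ : IsUniquelyErgodic T μ)
    (hT : Continuous T) {a : ℕ → ℂ} (ha : IsBesicovitchAlmostPeriodic a) {M : ℂ}
    (hM : Tendsto (cesaroAvg a) atTop (𝓝 M)) : HasErgodicMean T μ a M := by
  refine ⟨hM, fun f x => ?_⟩
  set g : ℕ → ℂ := fun n => f (T^[ArithmeticFunction.cardFactors n] x) with hg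
  set I := ∫ y, f y ∂μ with hI
  rw [Metric.tendsto_nhds]
  intro ε hε
  -- Half of `ε` covers replacing `a` by the polynomial, both in the average and in the mean; the
  -- other half is for the polynomial itself.
  set η := ε / (2 * (‖f‖ + ‖I‖ + 1)) with hη
  have hη0 : 0 < η := by positivity
  obtain ⟨L, c, α, h⟩ := ha.exists_trigPoly_approx hη0
  have hP := hμ.hasErgodicMean_trigPoly hT c α
  have h1 : ‖M - trigMean c α‖ ≤ η := by
    refine le_of_tendsto (hM.sub hP.1).norm (h.mono fun N hN => ?_)
    have h5 := norm_cesaroAvg_mul_sub_le (a := a) (b := trigPoly c α) (g := fun _ => 1) (D := 1)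
      (by simp) N
    simp only [mul_one] at h5
    exact h5.trans hN.le
  filter_upwards [h, Metric.tendsto_nhds.1 (hP.2 f x) (ε / 2) (half_pos hε)] with N hN1 hN2
  have h2 := norm_cesaroAvg_mul_sub_le (a := a) (b := trigPoly c α) (g := g) (D := ‖f‖)
    (fun n => f.norm_coe_le_norm _) N
  have h3 : ‖cesaroAvg (fun n => a n * g n) N - cesaroAvg (fun n => trigPoly c α n * g n) N‖ ≤
      η * ‖f‖ := h2.trans (by gcongr)
  rw [dist_eq_norm] at hN2 ⊢
  have e : cesaroAvg (fun n => a n * g n) N - M * I =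
      (cesaroAvg (fun n => a n * g n) N - cesaroAvg (fun n => trigPoly c α n * g n) N) +
      (cesaroAvg (fun n => trigPoly c α n * g n) N - trigMean c α * I) -
      (M - trigMean c α) * I := by ring
  rw [e]
  have h4 : ‖(M - trigMean c α) * I‖ ≤ η * ‖I‖ := by
    rw [norm_mul]
    gcongr
  have h5 : η * ‖f‖ + η * ‖I‖ ≤ ε / 2 := by
    rw [← mul_add, hη, div_mul_eq_mul_div, div_le_div_iff₀ (by positivity) two_pos]
    nlinarith [norm_nonneg f, norm_nonneg I]
  calc _ ≤ ‖cesaroAvg (fun n => a n * g n) N - cesaroAvg (fun n => trigPoly c α n * g n) N‖ +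
      ‖cesaroAvg (fun n => trigPoly c α n * g n) N - trigMean c α * I‖ +
      ‖(M - trigMean c α) * I‖ :=
        (norm_sub_le _ _).trans (add_le_add (norm_add_le _ _) le_rfl)
    _ < ε := by linarith

end ErgodicMean

/-! ### `k`-free numbers -/

/-- Periodic functions are trigonometric polynomials. -/
lemma exists_trigPoly_eq_periodic (q : ℕ) [NeZero q] (Φ : ZMod q → ℂ) :
    ∃ (L : ℕ) (c : Fin L → ℂ) (α : Fin L → ℝ), ∀ n : ℕ, trigPoly c α n = Φ n := by
  let e := Fintype.equivFin (ZMod q)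
  refine ⟨Fintype.card (ZMod q), fun i => (q : ℂ)⁻¹ * ZMod.dft Φ (e.symm i),
    fun i => ((e.symm i).val : ℝ) / q, fun n => ?_⟩
  have h1 : Φ n = (q : ℂ)⁻¹ • ∑ j, ZMod.stdAddChar (j * (n : ZMod q)) • ZMod.dft Φ j := by
    rw [← ZMod.invDFT_apply, LinearEquiv.symm_apply_apply]
  rw [h1, trigPoly, smul_eq_mul, Finset.mul_sum, ← e.symm.sum_comp]
  refine Finset.sum_congr rfl fun i _ => ?_
  have h2 : e.symm i * (n : ZMod q) = (((e.symm i).val * n : ℤ) : ZMod q) := by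
    push_cast
    rw [ZMod.natCast_zmod_val]
  rw [h2, ZMod.stdAddChar_coe, smul_eq_mul]
  push_cast
  rw [mul_assoc, mul_comm (ZMod.dft Φ _)]
  congr 3
  ring

lemma exists_periodic_kfree_truncation (k D : ℕ) : ∃ (L : ℕ) (c : Fin L → ℂ) (α : Fin L → ℝ),
    ∀ n : ℕ, trigPoly c α n = open Classical in if ∀ d ∈ Finset.Icc 2 D, ¬ d ^ k ∣ n then 1 else 0 := by
  classical
  -- Every `d^k` with `2 ≤ d ≤ D` divides `q`, so the sieve condition depends only on `n mod q`.
  set q := D.factorial ^ k with hq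
  have : NeZero q := ⟨pow_ne_zero _ D.factorial_ne_zero⟩
  obtain ⟨L, c, α, h⟩ := exists_trigPoly_eq_periodic q
    (fun x => if ∀ d ∈ Finset.Icc 2 D, ¬ d ^ k ∣ x.val then 1 else 0)
  refine ⟨L, c, α, fun n => (h n).trans ?_⟩
  refine if_congr (forall₂_congr fun d hd => not_congr ?_) rfl rfl
  rw [Finset.mem_Icc] at hd
  rw [ZMod.val_natCast]
  exact Nat.dvd_mod_iff (pow_dvd_pow_of_dvd (Nat.dvd_factorial (by omega) hd.2) k)

lemma le_of_pow_dvd {d k n : ℕ} (hk : 2 ≤ k) (hn : 1 ≤ n) (h : d ^ k ∣ n) : d ≤ n :=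
  (Nat.le_self_pow (by omega) d).trans (Nat.le_of_dvd hn h)

lemma card_filter_dvd_le (N m : ℕ) : ∑ n ∈ Finset.Icc 1 N, (if m ∣ n then (1 : ℝ) else 0) ≤ N / m := by
  rcases Nat.eq_zero_or_pos m with rfl | hm
  · rw [Finset.sum_eq_zero]
    · simp
    · intro n hn
      have := (Finset.mem_Icc.1 hn).1
      rw [if_neg (by rw [zero_dvd_iff]; omega)]
  · rw [← Finset.sum_filter, Finset.sum_const, nsmul_eq_mul, mul_one]
    have : (Finset.filter (fun n => m ∣ n) (Finset.Icc 1 N)).card = N / m := by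
      rw [← Nat.Ioc_filter_dvd_card_eq_div]
      rfl
    rw [this]
    exact Nat.cast_div_le

theorem isBesicovitchAlmostPeriodic_kfree {k : ℕ} (hk : 2 ≤ k) :
    IsBesicovitchAlmostPeriodic (fun n => if IsKFree k n then 1 else 0) := by
  classical
  refine ⟨⟨1, fun n _ => by split_ifs <;> simp⟩, fun ε hε => ?_⟩
  have hs : Summable fun d : ℕ => 1 / (d : ℝ) ^ k := Real.summable_one_div_nat_pow.2 (by omega)
  obtain ⟨s, hs⟩ := summable_iff_vanishing_norm.1 hs ε hε
  -- All of `s` lies in `[0, D]`, so every finite sum of `1/d^k` over `d > D` is below `ε`.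
  set D := s.sup id with hD
  obtain ⟨L, c, α, h⟩ := exists_periodic_kfree_truncation k D
  refine ⟨L, c, α, ?_⟩
  have hterm : ∀ n N : ℕ, 1 ≤ n → n ≤ N →
      ‖(if IsKFree k n then (1 : ℂ) else 0) - trigPoly c α n‖ ≤
        ∑ d ∈ Finset.Ioc D N, if d ^ k ∣ n then (1 : ℝ) else 0 := by
    intro n N hn hnN
    have h0 : 0 ≤ ∑ d ∈ Finset.Ioc D N, if d ^ k ∣ n then (1 : ℝ) else 0 :=
      Finset.sum_nonneg fun d _ => by split_ifs <;> norm_num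
    rw [h n]
    by_cases h1 : IsKFree k n
    · have h2 : ∀ d ∈ Finset.Icc 2 D, ¬ d ^ k ∣ n := fun d hd => h1 d (Finset.mem_Icc.1 hd).1
      rw [if_pos h1, if_pos h2, sub_self, norm_zero]
      exact h0
    · rw [if_neg h1]
      split_ifs with h2
      · unfold IsKFree at h1
        push Not at h1
        obtain ⟨d, hd1, hd⟩ := h1
        have hdD : D < d := by
          by_contra hle
          exact h2 d (Finset.mem_Icc.2 ⟨hd1, not_lt.1 hle⟩) hd
        have hdN : d ≤ N := (le_of_pow_dvd hk hn hd).trans hnN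
        have := Finset.single_le_sum (f := fun d => if d ^ k ∣ n then (1 : ℝ) else 0)
          (fun d _ => by split_ifs <;> norm_num) (Finset.mem_Ioc.2 ⟨hdD, hdN⟩)
        simp only [hd, if_true] at this
        simpa using this
      · simp
  have hbound : ∀ N : ℕ, (1 / (N : ℝ)) * ∑ n ∈ Finset.Icc 1 N,
      ‖(if IsKFree k n then (1 : ℂ) else 0) - trigPoly c α n‖ ≤ ε := by
    intro N
    rw [one_div, inv_mul_eq_div]
    refine div_le_of_le_mul₀ N.cast_nonneg hε.le ?_
    calc _ ≤ ∑ n ∈ Finset.Icc 1 N, ∑ d ∈ Finset.Ioc D N, if d ^ k ∣ n then (1 : ℝ) else 0 :=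
          Finset.sum_le_sum fun n hn =>
            hterm n N (Finset.mem_Icc.1 hn).1 (Finset.mem_Icc.1 hn).2
      _ = ∑ d ∈ Finset.Ioc D N, ∑ n ∈ Finset.Icc 1 N, if d ^ k ∣ n then (1 : ℝ) else 0 :=
          Finset.sum_comm
      _ ≤ ∑ d ∈ Finset.Ioc D N, N / ((d ^ k : ℕ) : ℝ) :=
          Finset.sum_le_sum fun d _ => card_filter_dvd_le N _
      _ = (∑ d ∈ Finset.Ioc D N, 1 / (d : ℝ) ^ k) * N := by
          rw [Finset.sum_mul]
          exact Finset.sum_congr rfl fun d _ => by push_cast; ring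
      _ ≤ ε * N := by
          gcongr
          refine (le_abs_self _).trans (hs _ ?_).le
          rw [Finset.disjoint_left]
          intro d hd hds
          have h1 : d ≤ D := Finset.le_sup (f := id) hds
          have := (Finset.mem_Ioc.1 hd).1
          omega
  exact limsup_le_of_le (isCoboundedUnder_le_of_le atTop (x := 0) fun N => by positivity)
    (Eventually.of_forall hbound)

/-! ### The density of the `k`-free numbers -/

lemma exists_kfree_decomposition {k : ℕ} (hk : 2 ≤ k) (n : ℕ) (hn : 1 ≤ n) :
    ∃ d m, 1 ≤ d ∧ n = d ^ k * m ∧ IsKFree k m := by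
  induction n using Nat.strong_induction_on with
  | _ n ih =>
    by_cases h : IsKFree k n
    · exact ⟨1, n, le_rfl, by simp, h⟩
    · unfold IsKFree at h
      push Not at h
      obtain ⟨e, he, m, hm⟩ := h
      have hm0 : 1 ≤ m := by
        rcases Nat.eq_zero_or_pos m with rfl | h
        · omega
        · exact h
      have hlt : m < n := by
        have : 1 < e ^ k := Nat.one_lt_pow (by omega) he
        rw [hm]
        nlinarith
      obtain ⟨d, m', hd, hmd, hf⟩ := ih m hlt hm0
      exact ⟨e * d, m', Nat.mul_pos (by omega) hd, by rw [hm, hmd, mul_pow, mul_assoc], hf⟩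

/-- After removal of the greatest common divisor, coprimality forces `x^k ∣ m'` and `y^k ∣ m`, so
both are 1. -/
lemma kfree_decomposition_unique {k d d' m m' : ℕ} (hd : 1 ≤ d) (hd' : 1 ≤ d')
    (h : d ^ k * m = d' ^ k * m') (hm : IsKFree k m) (hm' : IsKFree k m') : d = d' := by
  obtain ⟨g, x, y, hg, hxy, rfl, rfl⟩ := Nat.exists_coprime' (m := d) (n := d')
    (Nat.gcd_pos_of_pos_left _ hd)
  rw [mul_pow, mul_pow, mul_right_comm, mul_right_comm (y ^ k)] at h
  have h1 : x ^ k * m = y ^ k * m' := Nat.eq_of_mul_eq_mul_right (pow_pos hg k) h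
  have hc : Nat.Coprime (x ^ k) (y ^ k) := Nat.Coprime.pow k k hxy
  have hy : y ^ k ∣ m := hc.symm.dvd_of_dvd_mul_left ⟨m', h1⟩
  have hx : x ^ k ∣ m' := hc.dvd_of_dvd_mul_left ⟨m, h1.symm⟩
  have hx1 : ¬ 1 < x := fun h => hm' x h hx
  have hy1 : ¬ 1 < y := fun h => hm y h hy
  have hx0 : 0 < x := Nat.pos_of_mul_pos_right hd
  have hy0 : 0 < y := Nat.pos_of_mul_pos_right hd'
  have : x = y := by omega
  rw [this]

theorem tendsto_cesaroAvg_kfree {k : ℕ} (hk : 2 ≤ k) :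
    Tendsto (cesaroAvg fun n => if IsKFree k n then 1 else 0) atTop
      (𝓝 (1 / riemannZeta (k : ℂ))) := by
  obtain ⟨M, hM⟩ := (isBesicovitchAlmostPeriodic_kfree hk).exists_mean
  set a : ℕ → ℂ := fun n => if IsKFree k n then 1 else 0 with ha
  have hab : ∀ n, ‖a n‖ ≤ 1 := fun n => by simp only [ha]; split_ifs <;> simp
  -- `G N d` is the proportion of `n ≤ N` with `n = d^k m`, `m` `k`-free. These sum to 1 over `d`
  -- and tend to `M/d^k`, dominated by `1/d^k`, whence `M ζ(k) = 1`.
  set G : ℕ → ℕ → ℂ := fun N d => (N : ℂ)⁻¹ * ∑ m ∈ Finset.Icc 1 (N / d ^ k), a m with hG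
  have hG1 : ∀ N : ℕ, 0 < N → ∑' d, G N d = 1 := by
    intro N hN
    have hpos : ∀ d : ℕ, 1 ≤ d → 0 < d ^ k := fun d hd => pow_pos hd k
    have hsum : ∑ d ∈ Finset.Icc 1 N, ∑ m ∈ Finset.Icc 1 (N / d ^ k), a m = N := by
      have h1 : ∀ d ∈ Finset.Icc 1 N, ∑ m ∈ Finset.Icc 1 (N / d ^ k), a m =
          ∑ n ∈ Finset.Icc 1 N, if d ^ k ∣ n then a (n / d ^ k) else 0 := fun d hd => by
        have hd0 := hpos d (Finset.mem_Icc.1 hd).1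
        rw [sum_Icc_dvd _ hd0]
        exact Finset.sum_congr rfl fun m _ => by rw [Nat.mul_div_cancel_left _ hd0]
      rw [Finset.sum_congr rfl h1, Finset.sum_comm]
      have h2 : ∀ n ∈ Finset.Icc 1 N,
          ∑ d ∈ Finset.Icc 1 N, (if d ^ k ∣ n then a (n / d ^ k) else 0) = 1 := by
        intro n hn
        rw [Finset.mem_Icc] at hn
        obtain ⟨d, m, hd, hdm, hm⟩ := exists_kfree_decomposition hk n hn.1
        have hdn : d ^ k ∣ n := ⟨m, hdm⟩
        rw [Finset.sum_eq_single d]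
        · rw [if_pos hdn, hdm, Nat.mul_div_cancel_left _ (hpos d hd), ha]
          simp only
          rw [if_pos hm]
        · intro e he hed
          split_ifs with hen
          · simp only [ha]
            rw [if_neg]
            intro hf
            refine hed (kfree_decomposition_unique (Finset.mem_Icc.1 he).1 hd
              (m := n / e ^ k) (m' := m) ?_ hf hm)
            rw [Nat.mul_div_cancel' hen, hdm]
          · rfl
        · intro hd'
          exact absurd (Finset.mem_Icc.2 ⟨hd, (le_of_pow_dvd hk hn.1 hdn).trans hn.2⟩) hd'
      rw [Finset.sum_congr rfl h2]
      simp
    rw [tsum_eq_sum (s := Finset.Icc 1 N), ← Finset.mul_sum, hsum, inv_mul_cancel₀]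
    · exact_mod_cast hN.ne'
    · intro d hd
      have : N / d ^ k = 0 := by
        rcases Nat.eq_zero_or_pos d with rfl | hd0
        · rw [zero_pow (by omega), Nat.div_zero]
        · have hNd : N < d := by
            by_contra hle
            exact hd (Finset.mem_Icc.2 ⟨hd0, not_lt.1 hle⟩)
          exact Nat.div_eq_of_lt (hNd.trans_le (Nat.le_self_pow (by omega) d))
      simp [hG, this]
  have hlim : ∀ d : ℕ, Tendsto (fun N => G N d) atTop (𝓝 (M * (1 / (d : ℂ) ^ k))) := by
    intro d
    rcases Nat.eq_zero_or_pos d with rfl | hd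
    -- For `d = 0` both sides vanish, since division by zero gives zero.
    · simp [hG, zero_pow (show k ≠ 0 by omega)]
    · have hd0 : 0 < d ^ k := pow_pos hd k
      have hdc : (d : ℂ) ^ k ≠ 0 := by exact_mod_cast hd0.ne'
      have h1 : Tendsto (fun N : ℕ => N / d ^ k) atTop atTop :=
        Nat.tendsto_div_const_atTop hd0.ne'
      have h2 : Tendsto (fun N : ℕ => (((N / d ^ k : ℕ) : ℝ) / (N : ℝ))) atTop
          (𝓝 (1 / (d : ℝ) ^ k)) := by
        have := (tendsto_nat_floor_mul_div_atTop (R := ℝ) (a := 1 / (d : ℝ) ^ k)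
          (by positivity)).comp tendsto_natCast_atTop_atTop
        refine this.congr fun N => ?_
        simp only [Function.comp_apply]
        congr 2
        rw [one_div, inv_mul_eq_div, ← Nat.cast_pow, Nat.floor_div_natCast, Nat.floor_natCast]
      have h3 := (hM.comp h1).mul ((Complex.continuous_ofReal.tendsto _).comp h2)
      rw [Complex.ofReal_div, Complex.ofReal_one, Complex.ofReal_pow, Complex.ofReal_natCast] at h3
      refine h3.congr' ?_
      filter_upwards [h1.eventually_gt_atTop 0] with N hN
      simp only [Function.comp_apply, cesaroAvg, hG]
      have : ((N / d ^ k : ℕ) : ℂ) ≠ 0 := by exact_mod_cast hN.ne'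
      push_cast
      field_simp
  have hs : Summable fun d : ℕ => 1 / (d : ℝ) ^ k := Real.summable_one_div_nat_pow.2 (by omega)
  have key := tendsto_tsum_of_dominated_convergence hs hlim (Eventually.of_forall fun N d => by
    simp only [hG]
    rw [norm_mul, norm_inv, Complex.norm_natCast, inv_mul_eq_div]
    refine div_le_of_le_mul₀ N.cast_nonneg (by positivity) ?_
    refine (sum_Icc_norm_le (fun n _ => hab n) _).trans ?_
    rw [mul_one, one_div, inv_mul_eq_div]
    refine Nat.cast_div_le.trans_eq ?_
    push_cast
    rfl)
  have h1 : Tendsto (fun N => ∑' d, G N d) atTop (𝓝 1) := by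
    refine tendsto_const_nhds.congr' ?_
    filter_upwards [eventually_gt_atTop 0] with N hN
    exact (hG1 N hN).symm
  have h2 := tendsto_nhds_unique key h1
  rw [tsum_mul_left, ← zeta_nat_eq_tsum_of_gt_one (by omega)] at h2
  rw [one_div, ← eq_inv_of_mul_eq_one_left h2]
  exact hM

theorem mainTheorem12 {X : Type*} [MetricSpace X] [CompactSpace X] [MeasurableSpace X]
    [BorelSpace X] (T : X → X) (hT : Continuous T) (μ : Measure X)
    (hμ : IsUniquelyErgodic T μ) :
    (∀ a : ℕ → ℂ, IsBesicovitchAlmostPeriodic a →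
      ∃ M : ℂ, Tendsto (cesaroAvg a) atTop (𝓝 M) ∧
        ∀ (f : C(X, ℂ)) (x : X),
          Tendsto (cesaroAvg fun n => a n * f (T^[ArithmeticFunction.cardFactors n] x)) atTop
            (𝓝 (M * ∫ y, f y ∂μ))) ∧
    (∀ k : ℕ, 2 ≤ k →
      IsBesicovitchAlmostPeriodic (fun n => if IsKFree k n then 1 else 0) ∧
      Tendsto (cesaroAvg fun n => if IsKFree k n then 1 else 0) atTop
        (𝓝 (1 / riemannZeta (k : ℂ))) ∧
      ∀ (f : C(X, ℂ)) (x : X),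
        Tendsto (fun N : ℕ => (1 / (N : ℂ)) * ∑ n ∈ Finset.Icc 1 N with IsKFree k n,
            f (T^[ArithmeticFunction.cardFactors n] x)) atTop
          (𝓝 ((1 / riemannZeta (k : ℂ)) * ∫ y, f y ∂μ))) := by
  refine ⟨fun a ha => ?_, fun k hk => ?_⟩
  · obtain ⟨M, hM⟩ := ha.exists_mean
    exact ⟨M, hμ.hasErgodicMean_of_besicovitch hT ha hM⟩
  · have hB := isBesicovitchAlmostPeriodic_kfree hk
    have hM := tendsto_cesaroAvg_kfree hk
    refine ⟨hB, hM, fun f x => ?_⟩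
    refine ((hμ.hasErgodicMean_of_besicovitch hT hB hM).2 f x).congr fun N => ?_
    rw [cesaroAvg, Finset.sum_filter]
    simp only [ite_mul, one_mul, zero_mul]
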